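/- Let $q\in\mathbb C$ with $|q|<1$. Write $(x;q)_n=\prod_{j=0}^{n-1}(1-xq^j)$, $(x;q)_\infty=\prod_{j\ge 0}(1-xq^j)$ and $(x_1,\dots,x_m;q)_\infty=\prod_{l=1}^m (x_l;q)_\infty$. For positive integers $d,e,k$, put $K=k+d(e-1)$ and, for $1\le i\le K$, $$Q^{(d,e,k)}_i(a)=\frac{1}{(a^eq^e;q^e)_\infty}\sum_{n\ge 0}\frac{(-1)^n a^{Kn}\,q^{(K+\frac12)dn^2+(K+\frac12-i)dn}\,(1-a^iq^{(2n+1)di})\,(aq^d;q^d)_n}{(q^d;q^d)_n}.$$ Define $$F_1(a)=\sum_{n,r\ge 0}\frac{a^{2n+4r}q^{2n^2+4nr+4r^2+2n+4r}}{(-aq;q)_{2r+1}(q^2;q^2)_r(q^2;q^2)_n},\qquad F_2(a)=\sum_{n,r\ge 0}\frac{a^{2n+4r}q^{2n^2+4nr+4r^2+2n+4r}}{(-aq;q)_{2r}(q^2;q^2)_r(q^2;q^2)_n},$$ $$F_3(a)=\sum_{n,r\ge 0}\frac{a^{2n+4r}q^{2n^2+4nr+4r^2+2r}(1+aq^{2n+2r+1})}{(-aq;q)_{2r+1}(q^2;q^2)_r(q^2;q^2)_n},$$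 $$F_4(a)=\sum_{n,r\ge 0}\frac{a^{2n+4r}q^{2n^2+4nr+4r^2+2r}}{(-aq;q)_{2r}(q^2;q^2)_r(q^2;q^2)_n},\qquad F_5(a)=\sum_{n,r\ge 0}\frac{a^{2n+4r}q^{2n^2+4nr+4r^2}}{(-aq;q)_{2r}(q^2;q^2)_r(q^2;q^2)_n}.$$ (i) For every $a\in\mathbb C$ with $a^2q^{2j}\ne 1$ for all integers $j\ge 1$, the five double series and the series in $Q^{(1,2,4)}_i(a)$, $1\le i\le5$, converge absolutely, $(a^2q^2;q^2)_\infty\neq 0$, and $$F_i(a)=Q^{(1,2,4)}_i(a)\qquad(1\le i\le 5).$$ Moreover the $F_i$ satisfy the system of $q$-difference equations $$F_1(a)=\frac{1}{1+aq}F_5(aq),\qquad F_i(a)=F_{i-1}(a)+\frac{a^{i-1}q^{i-1}}{1+aq}F_{6-i}(aq)\quad(2\le i\le5),$$ with initial conditions $F_1(0)=\dots=F_5(0)=1$. (ii) Consequently (case $a=1$), one has $(q^2;q^2)_\infty\ne0$ and, the double series converging absolutely, $$\sum_{n,r\ge 0}\frac{q^{2n^2+4nr+4r^2+2n+4r}}{(-q;q)_{2r+1}(q^2;q^2)_r(q^2;q^2)_n}=\frac{(q,q^{10},q^{11};q^{11})_\infty}{(q^2;q^2)_\infty},$$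 $$\sum_{n,r\ge 0}\frac{q^{2n^2+4nr+4r^2+2n+4r}}{(-q;q)_{2r}(q^2;q^2)_r(q^2;q^2)_n}=\frac{(q^2,q^9,q^{11};q^{11})_\infty}{(q^2;q^2)_\infty},$$ $$\sum_{n,r\ge 0}\frac{q^{2n^2+4nr+4r^2+2r}(1+q^{2n+2r+1})}{(-q;q)_{2r+1}(q^2;q^2)_r(q^2;q^2)_n}=\frac{(q^3,q^8,q^{11};q^{11})_\infty}{(q^2;q^2)_\infty},$$ $$\sum_{n,r\ge 0}\frac{q^{2n^2+4nr+4r^2+2r}}{(-q;q)_{2r}(q^2;q^2)_r(q^2;q^2)_n}=\frac{(q^4,q^7,q^{11};q^{11})_\infty}{(q^2;q^2)_\infty},$$ $$\sum_{n,r\ge 0}\frac{q^{2n^2+4nr+4r^2}}{(-q;q)_{2r}(q^2;q^2)_r(q^2;q^2)_n}=\frac{(q^5,q^6,q^{11};q^{11})_\infty}{(q^2;q^2)_\infty}.$$ -/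

import Mathlib

/-- The finite `q`-shifted factorial `(x; q)_n = ∏_{j=0}^{n-1} (1 - x q^j)`. -/
def qPoch (x q : ℂ) (n : ℕ) : ℂ := ∏ j ∈ Finset.range n, (1 - x * q ^ j)

/-- The infinite `q`-shifted factorial `(x; q)_∞ = ∏_{j ≥ 0} (1 - x q^j)`. -/
noncomputable def qPochInf (x q : ℂ) : ℂ := ∏' j : ℕ, (1 - x * q ^ j)

/-- For `|q| < 1` the infinite product defining `(x; q)_∞` converges. -/
theorem multipliable_qPochInf (x q : ℂ) (hq : ‖q‖ < 1) :
    Multipliable (fun j : ℕ => 1 - x * q ^ j) := by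
  have h : Summable (fun j : ℕ => ‖-(x * q ^ j)‖) := by
    have := (summable_geometric_of_lt_one (norm_nonneg q) hq).mul_left ‖x‖
    simpa [norm_mul, norm_pow] using this
  simpa [sub_eq_add_neg] using multipliable_one_add_of_summable h

/-- The exponent `[K + 1/2] d n² + [K + 1/2 - i] d n`, where `K = k + d (e - 1)`, written as a
natural number (for `1 ≤ i ≤ K`); see `QExponent_cast`. -/
def QExponent (d e k i n : ℕ) : ℕ :=
  d * ((k + d * (e - 1)) * n ^ 2 + (k + d * (e - 1) - i) * n + n * (n + 1) / 2)

theorem QExponent_cast (d e k i n : ℕ) (he : 1 ≤ e) (hi : i ≤ k + d * (e - 1)) :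
    (QExponent d e k i n : ℚ) =
      ((k : ℚ) + d * ((e : ℚ) - 1) + 1 / 2) * d * (n : ℚ) ^ 2 +
        ((k : ℚ) + d * ((e : ℚ) - 1) + 1 / 2 - i) * d * n := by
  have h2 : ((n * (n + 1) / 2 : ℕ) : ℚ) = (n : ℚ) * (n + 1) / 2 := by
    rw [Nat.cast_div (Nat.even_mul_succ_self n).two_dvd (by norm_num)]
    push_cast
    ring
  unfold QExponent
  rw [Nat.cast_mul, Nat.cast_add, Nat.cast_add, h2, Nat.cast_mul, Nat.cast_mul, Nat.cast_sub hi]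
  push_cast [Nat.cast_sub he]
  ring

/-- The `n`-th term of the series in the definition of `Q^{(d,e,k)}_i(a)`. -/
noncomputable def QTerm (d e k i : ℕ) (a q : ℂ) (n : ℕ) : ℂ :=
  (-1) ^ n * a ^ ((k + d * (e - 1)) * n) * q ^ QExponent d e k i n
      * (1 - a ^ i * q ^ ((2 * n + 1) * d * i)) * qPoch (a * q ^ d) (q ^ d) n
    / qPoch (q ^ d) (q ^ d) n

/-- `Q^{(d,e,k)}_i(a)`, for `1 ≤ i ≤ k + d (e - 1)`. -/
noncomputable def Q (d e k i : ℕ) (a q : ℂ) : ℂ :=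
  1 / qPochInf (a ^ e * q ^ e) (q ^ e) * ∑' n : ℕ, QTerm d e k i a q n

/-- The `(n, r)`-th term of the explicit double series `F^{(1,2,4)}_i(a)`, `1 ≤ i ≤ 5`
(and `0`, irrelevantly, for other `i`). -/
noncomputable def F124Term (i : ℕ) (a q : ℂ) (n r : ℕ) : ℂ :=
  match i with
  | 1 => a ^ (2 * n + 4 * r) * q ^ (2 * n ^ 2 + 4 * n * r + 4 * r ^ 2 + 2 * n + 4 * r)
      / (qPoch (-a * q) q (2 * r + 1) * qPoch (q ^ 2) (q ^ 2) r * qPoch (q ^ 2) (q ^ 2) n)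
  | 2 => a ^ (2 * n + 4 * r) * q ^ (2 * n ^ 2 + 4 * n * r + 4 * r ^ 2 + 2 * n + 4 * r)
      / (qPoch (-a * q) q (2 * r) * qPoch (q ^ 2) (q ^ 2) r * qPoch (q ^ 2) (q ^ 2) n)
  | 3 => a ^ (2 * n + 4 * r) * q ^ (2 * n ^ 2 + 4 * n * r + 4 * r ^ 2 + 2 * r)
        * (1 + a * q ^ (2 * n + 2 * r + 1))
      / (qPoch (-a * q) q (2 * r + 1) * qPoch (q ^ 2) (q ^ 2) r * qPoch (q ^ 2) (q ^ 2) n)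
  | 4 => a ^ (2 * n + 4 * r) * q ^ (2 * n ^ 2 + 4 * n * r + 4 * r ^ 2 + 2 * r)
      / (qPoch (-a * q) q (2 * r) * qPoch (q ^ 2) (q ^ 2) r * qPoch (q ^ 2) (q ^ 2) n)
  | 5 => a ^ (2 * n + 4 * r) * q ^ (2 * n ^ 2 + 4 * n * r + 4 * r ^ 2)
      / (qPoch (-a * q) q (2 * r) * qPoch (q ^ 2) (q ^ 2) r * qPoch (q ^ 2) (q ^ 2) n)
  | _ => 0

/-- The explicit double series `F^{(1,2,4)}_i(a)`, `1 ≤ i ≤ 5`. -/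
noncomputable def F124 (i : ℕ) (a q : ℂ) : ℂ :=
  ∑' p : ℕ × ℕ, F124Term i a q p.1 p.2

/-! Both families solve the same system of `q`-difference equations, and that system has only one
solution normalised at `a = 0`. With `X_0 = 0`, the system reads `X_{s+1}(a) = X_s(a) + (aq)^s / (1
+ aq) * X_{5-s}(aq)` for `0 ≤ s ≤ 4`.

For the double series (`F124_one` to `F124_five`) the equations come from lengthening `(-aq; q)_L`
by one factor and from cancelling `1 - q^(2n)` or `1 - q^(2r)` against the last factor of `(q²;
q²)_n` or `(q²; q²)_r`, which turns into an index shift. For `Q` (`Q_succ`) the difference of the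
two sides telescopes.

Uniqueness (`F124_eq_Q`): the difference vector `D` satisfies `‖D(a)‖ ≤ (1 + O(|aq|)) ‖D(aq)‖`.
Along `a, aq, aq², ...` the product of these factors stays bounded, while `D(a q^m) → 0` because
both families tend to `1`. Hence `D(a) = 0`. Only limits along this one sequence are needed, and
they follow from dominated convergence.

At `a = 1` the quotient `(q; q)_n / (q; q)_n` drops out of `Q`, leaving a theta series in base
`q^11`, which the Jacobi triple product (`tripleProduct`) factors. -/

open Filter Topology

/-! ### Finite and infinite `q`-shifted factorials. -/

theorem qPoch_zero (x q : ℂ) : qPoch x q 0 = 1 := by simp [qPoch]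

theorem qPoch_succ (x q : ℂ) (n : ℕ) : qPoch x q (n + 1) = qPoch x q n * (1 - x * q ^ n) :=
  Finset.prod_range_succ _ _

theorem qPoch_add (x q : ℂ) (m n : ℕ) :
    qPoch x q (m + n) = qPoch x q m * qPoch (x * q ^ m) q n := by
  unfold qPoch
  rw [Finset.prod_range_add]
  congr 1
  exact Finset.prod_congr rfl fun j _ => by rw [pow_add]; ring

theorem qPoch_succ' (x q : ℂ) (n : ℕ) : qPoch x q (n + 1) = (1 - x) * qPoch (x * q) q n := by
  rw [add_comm, qPoch_add]
  simp [qPoch]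

theorem qPoch_ne_zero {x q : ℂ} (h : ∀ j : ℕ, x * q ^ j ≠ 1) (n : ℕ) : qPoch x q n ≠ 0 :=
  Finset.prod_ne_zero_iff.mpr fun j _ => sub_ne_zero.mpr (h j).symm

theorem continuous_qPoch (q : ℂ) (n : ℕ) : Continuous fun x => qPoch x q n := by
  unfold qPoch
  fun_prop

theorem tendsto_qPoch (x : ℂ) {q : ℂ} (hq : ‖q‖ < 1) :
    Tendsto (qPoch x q) atTop (𝓝 (qPochInf x q)) :=
  (multipliable_qPochInf x q hq).tendsto_prod_tprod_nat

theorem qPochInf_ne_zero {x q : ℂ} (hq : ‖q‖ < 1) (h : ∀ j : ℕ, x * q ^ j ≠ 1) :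
    qPochInf x q ≠ 0 := by
  have h1 : Summable (fun j : ℕ => ‖-(x * q ^ j)‖) := by
    have := (summable_geometric_of_lt_one (norm_nonneg q) hq).mul_left ‖x‖
    simpa [norm_mul, norm_pow] using this
  have := tprod_one_add_ne_zero_of_summable (f := fun j : ℕ => -(x * q ^ j))
    (fun j => by rw [← sub_eq_add_neg]; exact sub_ne_zero.mpr (h j).symm) h1
  simpa [qPochInf, sub_eq_add_neg] using this

theorem qPochInf_eq_mul (x : ℂ) {q : ℂ} (hq : ‖q‖ < 1) (m : ℕ) :
    qPochInf x q = qPoch x q m * qPochInf (x * q ^ m) q := by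
  have h1 : Tendsto (fun n => qPoch x q (m + n)) atTop (𝓝 (qPochInf x q)) := by
    simpa only [add_comm m] using (tendsto_add_atTop_iff_nat m).mpr (tendsto_qPoch x hq)
  simp only [qPoch_add] at h1
  exact tendsto_nhds_unique h1 ((tendsto_qPoch _ hq).const_mul _)

theorem tendsto_qPochInf_shift {x q : ℂ} (hq : ‖q‖ < 1) (h : ∀ j : ℕ, x * q ^ j ≠ 1) :
    Tendsto (fun m => qPochInf (x * q ^ m) q) atTop (𝓝 1) := by
  have h0 := qPochInf_ne_zero hq h
  have h1 := (tendsto_const_nhds (x := qPochInf x q)).div (tendsto_qPoch x hq) h0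
  rw [div_self h0] at h1
  refine h1.congr fun m => ?_
  rw [Pi.div_apply, qPochInf_eq_mul x hq m, mul_div_cancel_left₀ _ (qPoch_ne_zero h m)]

theorem norm_qPoch_le (x : ℂ) {q : ℂ} (hq : ‖q‖ < 1) (n : ℕ) :
    ‖qPoch x q n‖ ≤ Real.exp (‖x‖ / (1 - ‖q‖)) := by
  have hs := (summable_geometric_of_lt_one (norm_nonneg q) hq).mul_left ‖x‖
  calc ‖qPoch x q n‖ = ∏ j ∈ Finset.range n, ‖1 - x * q ^ j‖ := by simp [qPoch, norm_prod]
    _ ≤ ∏ j ∈ Finset.range n, (1 + ‖x‖ * ‖q‖ ^ j) := by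
        refine Finset.prod_le_prod (fun _ _ => norm_nonneg _) fun j _ => ?_
        refine (norm_sub_le _ _).trans ?_
        simp
    _ ≤ Real.exp (∑ j ∈ Finset.range n, ‖x‖ * ‖q‖ ^ j) :=
        Real.prod_one_add_le_exp_sum _ fun j => by positivity
    _ ≤ Real.exp (‖x‖ / (1 - ‖q‖)) := by
        refine Real.exp_le_exp.mpr ((hs.sum_le_tsum _ fun j _ => by positivity).trans_eq ?_)
        rw [tsum_mul_left, tsum_geometric_of_lt_one (norm_nonneg q) hq, div_eq_mul_inv]

/-- Since `1 / (xq^m; q)_n = (x; q)_m / (x; q)_{m+n}`, it suffices that the numerators are bounded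
and that the reciprocals converge, the limit `(x; q)_∞` being nonzero. Uniformity in `m` provides
the dominating series along `a q^m`. -/
theorem exists_norm_inv_qPoch_le {x q : ℂ} (hq : ‖q‖ < 1) (h : ∀ j : ℕ, x * q ^ j ≠ 1) :
    ∃ C : ℝ, 0 ≤ C ∧ ∀ m n, ‖(qPoch (x * q ^ m) q n)⁻¹‖ ≤ C := by
  have h1 := (tendsto_qPoch x hq).inv₀ (qPochInf_ne_zero hq h)
  obtain ⟨C, hC⟩ := h1.norm.bddAbove_range
  have hC' : ∀ n, ‖(qPoch x q n)⁻¹‖ ≤ C := fun n => hC ⟨n, rfl⟩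
  have hC0 : 0 ≤ C := (norm_nonneg _).trans (hC' 0)
  refine ⟨Real.exp (‖x‖ / (1 - ‖q‖)) * C, by positivity, fun m n => ?_⟩
  have : (qPoch (x * q ^ m) q n)⁻¹ = qPoch x q m * (qPoch x q (m + n))⁻¹ := by
    rw [qPoch_add, mul_inv, mul_inv_cancel_left₀ (qPoch_ne_zero h m)]
  rw [this, norm_mul]
  exact mul_le_mul (norm_qPoch_le x hq m) (hC' _) (norm_nonneg _) (by positivity)

theorem self_pow_mul_ne_one {q : ℂ} (hq : ‖q‖ < 1) (j : ℕ) : q * q ^ j ≠ 1 := by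
  intro h
  have := congrArg norm h
  rw [← pow_succ', norm_pow, norm_one] at this
  exact (pow_lt_one₀ (norm_nonneg q) hq j.succ_ne_zero).ne this

theorem norm_pow_lt_one {q : ℂ} (hq : ‖q‖ < 1) {n : ℕ} (hn : n ≠ 0) : ‖q ^ n‖ < 1 := by
  rw [norm_pow]
  exact pow_lt_one₀ (norm_nonneg q) hq hn

/-! ### Majorants, the uniqueness principle, and index shifts. -/

theorem summable_pow_mul_pow_choose (A : ℝ) {ρ : ℝ} (h0 : 0 ≤ ρ) (h1 : ρ < 1) :
    Summable fun n : ℕ => A ^ n * ρ ^ n.choose 2 := by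
  refine summable_of_ratio_norm_eventually_le (r := 1 / 2) (by norm_num) ?_
  have h : Tendsto (fun n : ℕ => |A| * ρ ^ n) atTop (𝓝 0) := by
    simpa using (tendsto_pow_atTop_nhds_zero_of_lt_one h0 h1).const_mul |A|
  filter_upwards [h.eventually_le_const (show (0 : ℝ) < 1 / 2 by norm_num)] with n hn
  have e : A ^ (n + 1) * ρ ^ (n + 1).choose 2 = (A * ρ ^ n) * (A ^ n * ρ ^ n.choose 2) := by
    rw [Nat.choose_succ_succ' n 1, Nat.choose_one_right]
    ring
  rw [e, norm_mul]
  refine mul_le_mul_of_nonneg_right ?_ (norm_nonneg _)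
  rwa [norm_mul, Real.norm_eq_abs, Real.norm_eq_abs, abs_of_nonneg (pow_nonneg h0 n)]

theorem choose_two_le_sq (n : ℕ) : n.choose 2 ≤ n ^ 2 := by
  rw [Nat.choose_two_right, sq]
  exact (Nat.div_le_self _ _).trans (Nat.mul_le_mul_left _ (Nat.sub_le _ _))

theorem triangle_succ (n : ℕ) : (n + 1) * (n + 1 + 1) / 2 = n * (n + 1) / 2 + (n + 1) := by
  have : (n + 1) * (n + 1 + 1) = n * (n + 1) + (n + 1) * 2 := by ring
  rw [this, Nat.add_mul_div_right _ _ (by norm_num)]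

theorem choose_two_le_triangle (n : ℕ) : n.choose 2 ≤ n * (n + 1) / 2 := by
  rw [Nat.choose_two_right]
  exact Nat.div_le_div_right (Nat.mul_le_mul_left _ (by omega))

/-- Iterating gives `‖x 0‖ ≤ ∏ (1 + c m) * ‖x M‖`, and the product is at most `exp (∑ c)` for every
`M`. This is the uniqueness principle for the `q`-difference system. -/
theorem tendsto_zero_of_norm_le_one_add_mul {E : Type*} [NormedAddCommGroup E] {x : ℕ → E}
    {c : ℕ → ℝ} (hc0 : ∀ m, 0 ≤ c m) (hc : Summable c)
    (hx : ∀ m, ‖x m‖ ≤ (1 + c m) * ‖x (m + 1)‖) (hlim : Tendsto x atTop (𝓝 0)) : x 0 = 0 := by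
  have key : ∀ M, ‖x 0‖ ≤ (∏ m ∈ Finset.range M, (1 + c m)) * ‖x M‖ := by
    intro M
    induction M with
    | zero => simp
    | succ M ih =>
      refine ih.trans ?_
      rw [Finset.prod_range_succ, mul_assoc]
      exact mul_le_mul_of_nonneg_left (hx M)
        (Finset.prod_nonneg fun m _ => by linarith [hc0 m])
  have key2 : ∀ M, ‖x 0‖ ≤ Real.exp (∑' m, c m) * ‖x M‖ := fun M => (key M).trans <|
    mul_le_mul_of_nonneg_right ((Real.prod_one_add_le_exp_sum _ hc0).trans
      (Real.exp_le_exp.mpr (hc.sum_le_tsum _ fun m _ => hc0 m))) (norm_nonneg _)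
  have h3 : Tendsto (fun M => Real.exp (∑' m, c m) * ‖x M‖) atTop (𝓝 0) := by
    simpa using hlim.norm.const_mul (Real.exp (∑' m, c m))
  exact norm_le_zero_iff.mp (ge_of_tendsto' h3 key2)

/-- Only the support of `g` matters, so no summability is required. -/
theorem tsum_prod_shift_left {g : ℕ × ℕ → ℂ} (h : ∀ r, g (0, r) = 0) :
    ∑' p, g p = ∑' p : ℕ × ℕ, g (p.1 + 1, p.2) := by
  have hi : Function.Injective fun p : ℕ × ℕ => (p.1 + 1, p.2) := fun p p' hp => by
    simp only [Prod.mk.injEq, add_left_inj] at hp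
    exact Prod.ext hp.1 hp.2
  refine (hi.tsum_eq fun p hp => ?_).symm
  obtain ⟨_ | n, r⟩ := p
  · exact absurd (h r) hp
  · exact ⟨(n, r), rfl⟩

theorem tsum_prod_shift_right {g : ℕ × ℕ → ℂ} (h : ∀ n, g (n, 0) = 0) :
    ∑' p, g p = ∑' p : ℕ × ℕ, g (p.1, p.2 + 1) := by
  have hi : Function.Injective fun p : ℕ × ℕ => (p.1, p.2 + 1) := fun p p' hp => by
    simp only [Prod.mk.injEq, add_left_inj] at hp
    exact Prod.ext hp.1 hp.2
  refine (hi.tsum_eq fun p hp => ?_).symm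
  obtain ⟨n, _ | r⟩ := p
  · exact absurd (h n) hp
  · exact ⟨(n, r), rfl⟩

theorem tsum_shift {g : ℕ → ℂ} (h : g 0 = 0) : ∑' n, g n = ∑' n, g (n + 1) := by
  refine ((add_left_injective 1).tsum_eq fun n hn => ?_).symm
  obtain _ | n := n
  · exact absurd h hn
  · exact ⟨n, rfl⟩

/-! ### Gaussian binomials and the Jacobi triple product. -/

/-- The reciprocal `1 / (Q; Q)_{N - k}`, which is `0` when `k > N`. -/
noncomputable def qRecip (Q : ℂ) (N k : ℕ) : ℂ := if k ≤ N then (qPoch Q Q (N - k))⁻¹ else 0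

/-- The central Gaussian binomial coefficient `[2N; N + k]`. -/
noncomputable def centralGauss (Q : ℂ) (N k : ℕ) : ℂ :=
  qPoch Q Q (2 * N) * (qPoch Q Q (N + k))⁻¹ * qRecip Q N k

theorem qRecip_succ_succ (Q : ℂ) (N k : ℕ) : qRecip Q (N + 1) (k + 1) = qRecip Q N k := by
  simp [qRecip]

/-- The boundary case `k = N` is included: the left side is `0` by convention, and `1 - Q ^ 0 = 0`
on the right. -/
theorem qRecip_succ {Q : ℂ} (hQ : ‖Q‖ < 1) {N k : ℕ} (h : k ≤ N) :
    qRecip Q N (k + 1) = (1 - Q ^ (N - k)) * qRecip Q N k := by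
  obtain ⟨d, rfl⟩ := Nat.exists_eq_add_of_le h
  rcases d with _ | d
  · simp [qRecip]
  · have h1 : k + (d + 1) - (k + 1) = d := by omega
    have h2 : k + (d + 1) - k = d + 1 := by omega
    rw [qRecip, qRecip, if_pos (by omega), if_pos h, h1, h2, qPoch_succ, ← pow_succ', mul_inv,
      mul_left_comm, mul_inv_cancel₀, mul_one]
    rw [pow_succ']
    exact sub_ne_zero.mpr (self_pow_mul_ne_one hQ d).symm

theorem qRecip_of_lt (Q : ℂ) {N k : ℕ} (h : N < k) : qRecip Q N k = 0 := if_neg (by omega)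

theorem centralGauss_of_lt (Q : ℂ) {N k : ℕ} (h : N < k) : centralGauss Q N k = 0 := by
  simp [centralGauss, qRecip_of_lt Q h]

theorem inv_qPoch_self {Q : ℂ} (hQ : ‖Q‖ < 1) (n : ℕ) :
    (qPoch Q Q n)⁻¹ = (1 - Q ^ (n + 1)) * (qPoch Q Q (n + 1))⁻¹ := by
  have : 1 - Q ^ (n + 1) ≠ 0 := by
    rw [pow_succ']
    exact sub_ne_zero.mpr (self_pow_mul_ne_one hQ n).symm
  rw [qPoch_succ, ← pow_succ', mul_inv, mul_left_comm, mul_inv_cancel₀ this, mul_one]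

theorem centralGauss_succ_zero {Q : ℂ} (hQ : ‖Q‖ < 1) (N : ℕ) :
    centralGauss Q (N + 1) 0
      = (1 + Q ^ (2 * N + 1)) * centralGauss Q N 0 + 2 * Q ^ (N + 1) * centralGauss Q N 1 := by
  have h1 : 1 - Q ^ (N + 1) ≠ 0 := by
    rw [pow_succ']
    exact sub_ne_zero.mpr (self_pow_mul_ne_one hQ N).symm
  have h2 := qRecip_succ hQ (Nat.zero_le (N + 1))
  rw [qRecip_succ_succ] at h2
  have h3 : qRecip Q (N + 1) 0 = qRecip Q N 0 / (1 - Q ^ (N + 1)) := by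
    rw [h2]
    field_simp
    simp
  have h4 := qRecip_succ hQ (Nat.zero_le N)
  simp only [centralGauss, h3, h4, Nat.sub_zero, add_zero]
  rw [show 2 * (N + 1) = 2 * N + 1 + 1 by ring, qPoch_succ, qPoch_succ, inv_qPoch_self hQ N]
  field_simp
  ring

/-- Two applications of the `q`-Pascal rule, from row `2N` to row `2N + 2`. The factor `Q ^ k`
clears the exponent `N - k`, which is negative for `k > N`. -/
theorem centralGauss_succ_succ {Q : ℂ} (hQ : ‖Q‖ < 1) (N k : ℕ) :
    Q ^ k * centralGauss Q (N + 1) (k + 1)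
      = (1 + Q ^ (2 * N + 1)) * (Q ^ k * centralGauss Q N (k + 1))
        + Q ^ N * (centralGauss Q N k + Q * (Q ^ (2 * k + 1) * centralGauss Q N (k + 2))) := by
  rcases lt_trichotomy k N with h | rfl | h
  · obtain ⟨d, rfl⟩ := Nat.exists_eq_add_of_lt h
    have r1 := qRecip_succ hQ h.le
    have r2 := qRecip_succ hQ (show k + 1 ≤ k + d + 1 by omega)
    rw [show k + d + 1 - k = d + 1 by omega] at r1
    rw [show k + d + 1 - (k + 1) = d by omega, r1] at r2
    simp only [centralGauss]
    rw [qRecip_succ_succ Q (k + d + 1) k, show k + 2 = k + 1 + 1 by ring, r2, r1,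
      show 2 * (k + d + 1 + 1) = 2 * (k + d + 1) + 1 + 1 by ring, qPoch_succ, qPoch_succ,
      inv_qPoch_self hQ (k + d + 1 + k),
      show k + d + 1 + (k + 1) = k + d + 1 + k + 1 by ring,
      inv_qPoch_self hQ (k + d + 1 + k + 1),
      show k + d + 1 + (k + 1 + 1) = k + d + 1 + k + 1 + 1 by ring,
      show k + d + 1 + 1 + (k + 1) = k + d + 1 + k + 1 + 1 by ring]
    ring
  · rw [centralGauss_of_lt Q (show k < k + 1 by omega),
      centralGauss_of_lt Q (show k < k + 2 by omega)]
    have h1 : ∀ m, centralGauss Q m m = 1 := fun m => by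
      have := qPoch_ne_zero (self_pow_mul_ne_one hQ) (2 * m)
      simp [centralGauss, qRecip, ← two_mul, qPoch_zero, this]
    simp [h1]
  · simp [centralGauss_of_lt Q (show N < k + 1 by omega), centralGauss_of_lt Q h,
      centralGauss_of_lt Q (show N < k + 2 by omega),
      centralGauss_of_lt Q (show N + 1 < k + 1 by omega)]

/-- It rests on `(x + y)(x^(k+1) + y^(k+1)) = (x^(k+2) + y^(k+2)) + xy (x^k + y^k)`; the two extra
terms on the left are what truncation at `M` leaves over. -/
theorem add_mul_sum_pow_add_pow (x y : ℂ) (b : ℕ → ℂ) (M : ℕ) :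
    (x + y) * (b 0 + ∑ k ∈ Finset.range M, b (k + 1) * (x ^ (k + 1) + y ^ (k + 1)))
        + x * y * b (M + 1) * (x ^ M + y ^ M) + x * y * b (M + 2) * (x ^ (M + 1) + y ^ (M + 1))
      = 2 * (x * y) * b 1
        + ∑ k ∈ Finset.range (M + 1),
            (b k + x * y * b (k + 2)) * (x ^ (k + 1) + y ^ (k + 1)) := by
  induction M with
  | zero => simp; ring
  | succ M ih =>
    rw [Finset.sum_range_succ, Finset.sum_range_succ _ (M + 1), ← add_assoc (2 * (x * y) * b 1),
      ← ih]
    ring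

/-- Induction on `N`: multiply by `(1 - xQ^N)(1 - yQ^N) = 1 - Q^N (x + y) + Q^(2N+1)` and compare
coefficients. Folding negative powers of `x` into powers of `y = Q / x` keeps the formula valid when
`x` or `y` is `0`. -/
theorem finite_tripleProduct {x y : ℂ} (hQ : ‖x * y‖ < 1) (N : ℕ) : ∀ M, N ≤ M →
    qPoch x (x * y) N * qPoch y (x * y) N
      = centralGauss (x * y) N 0 + ∑ k ∈ Finset.range M,
          (-1) ^ (k + 1) * (x * y) ^ (k.choose 2 + k) * centralGauss (x * y) N (k + 1)
            * (x ^ (k + 1) + y ^ (k + 1)) := by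
  set Q := x * y with hQdef
  induction N with
  | zero =>
    intro M _
    rw [Finset.sum_eq_zero fun k _ => by rw [centralGauss_of_lt Q k.succ_pos]; ring]
    simp [centralGauss, qRecip, qPoch_zero]
  | succ N ih =>
    intro M hM
    obtain ⟨M, rfl⟩ : ∃ m, M = m + 1 := ⟨M - 1, by omega⟩
    set b : ℕ → ℂ := fun k => (-1) ^ k * Q ^ k.choose 2 * centralGauss Q N k with hb
    have hch : ∀ k : ℕ, (k + 1).choose 2 = k.choose 2 + k := fun k => by
      rw [Nat.choose_succ_succ' k 1, Nat.choose_one_right, add_comm]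
    -- The upper limit is left free because the hypothesis is used at both `M` and `M + 1`.
    have hIH : ∀ m, N ≤ m → qPoch x Q N * qPoch y Q N
        = b 0 + ∑ k ∈ Finset.range m, b (k + 1) * (x ^ (k + 1) + y ^ (k + 1)) := fun m hm => by
      rw [ih m hm]
      simp [hb, hch]
    have key := add_mul_sum_pow_add_pow x y b M
    have hz : ∀ k, N < k → b k = 0 := fun k hk => by simp [hb, centralGauss_of_lt Q hk]
    rw [← hIH M (by omega), hz (M + 1) (by omega), hz (M + 2) (by omega), ← hQdef] at key
    have hrec : ∀ k, (-1) ^ (k + 1) * Q ^ (k.choose 2 + k) * centralGauss Q (N + 1) (k + 1)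
        = (1 + Q ^ (2 * N + 1)) * b (k + 1) - Q ^ N * (b k + Q * b (k + 2)) := fun k => by
      have := centralGauss_succ_succ hQ N k
      simp only [hb, hch]
      linear_combination ((-1) ^ (k + 1) * Q ^ k.choose 2) * this
    simp only [hrec, sub_mul, Finset.sum_sub_distrib]
    have e1 : ∑ k ∈ Finset.range (M + 1),
        (1 + Q ^ (2 * N + 1)) * b (k + 1) * (x ^ (k + 1) + y ^ (k + 1))
        = (1 + Q ^ (2 * N + 1)) * (qPoch x Q N * qPoch y Q N - b 0) := by
      rw [hIH (M + 1) (by omega), add_sub_cancel_left, Finset.mul_sum]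
      exact Finset.sum_congr rfl fun k _ => by ring
    have e2 : ∑ k ∈ Finset.range (M + 1),
        Q ^ N * (b k + Q * b (k + 2)) * (x ^ (k + 1) + y ^ (k + 1))
        = Q ^ N * ((x + y) * (qPoch x Q N * qPoch y Q N) - 2 * Q * b 1) := by
      rw [show (x + y) * (qPoch x Q N * qPoch y Q N) - 2 * Q * b 1
        = ∑ k ∈ Finset.range (M + 1), (b k + Q * b (k + 2)) * (x ^ (k + 1) + y ^ (k + 1)) by
          linear_combination key, Finset.mul_sum]
      exact Finset.sum_congr rfl fun k _ => by ring
    rw [e1, e2, centralGauss_succ_zero hQ, qPoch_succ, qPoch_succ]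
    have hb0 : b 0 = centralGauss Q N 0 := by simp [hb]
    have hb1 : b 1 = -centralGauss Q N 1 := by simp [hb]
    rw [hb0, hb1]
    linear_combination (-(qPoch x Q N * qPoch y Q N) * Q ^ (2 * N)) * hQdef

theorem summable_theta {Q : ℂ} (hQ : ‖Q‖ < 1) (z : ℂ) :
    Summable fun n : ℕ => (-1) ^ n * Q ^ n.choose 2 * z ^ n := by
  refine Summable.of_norm ?_
  refine (summable_pow_mul_pow_choose ‖z‖ (norm_nonneg Q) hQ).congr fun n => ?_
  simp [mul_comm]

theorem exists_norm_centralGauss_le {Q : ℂ} (hQ : ‖Q‖ < 1) :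
    ∃ C : ℝ, 0 ≤ C ∧ ∀ N k, ‖centralGauss Q N k‖ ≤ C := by
  obtain ⟨C, hC0, hC⟩ := exists_norm_inv_qPoch_le hQ (self_pow_mul_ne_one hQ)
  have hC' : ∀ n, ‖(qPoch Q Q n)⁻¹‖ ≤ C := fun n => by simpa using hC 0 n
  have hr : ∀ N k, ‖qRecip Q N k‖ ≤ C := fun N k => by
    unfold qRecip
    split_ifs
    · exact hC' _
    · simpa using hC0
  refine ⟨Real.exp (‖Q‖ / (1 - ‖Q‖)) * C * C, by positivity, fun N k => ?_⟩
  rw [centralGauss, norm_mul, norm_mul]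
  gcongr
  · exact norm_qPoch_le Q hQ _
  · exact hC' _
  · exact hr _ _

theorem tendsto_centralGauss {Q : ℂ} (hQ : ‖Q‖ < 1) (k : ℕ) :
    Tendsto (fun N => centralGauss Q N k) atTop (𝓝 (qPochInf Q Q)⁻¹) := by
  have hne := qPochInf_ne_zero hQ (self_pow_mul_ne_one hQ)
  have h0 := tendsto_qPoch Q hQ
  have h1 := h0.comp (tendsto_id.const_mul_atTop' (show 0 < 2 by norm_num))
  have h2 := (h0.comp (tendsto_add_atTop_nat k)).inv₀ hne
  have h3 := (h0.comp (tendsto_sub_atTop_nat k)).inv₀ hne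
  have h4 := (h1.mul h2).mul h3
  rw [mul_inv_cancel₀ hne, one_mul] at h4
  refine h4.congr' ?_
  filter_upwards [eventually_ge_atTop k] with N hN
  simp [centralGauss, qRecip, hN]

theorem summable_tripleProduct_term {Q : ℂ} (hQ : ‖Q‖ < 1) (z : ℂ) :
    Summable fun k : ℕ => (-1) ^ (k + 1) * Q ^ (k.choose 2 + k) * z ^ (k + 1) := by
  refine ((summable_nat_add_iff 1).mpr (summable_theta hQ z)).congr fun k => ?_
  rw [Nat.choose_succ_succ' k 1, Nat.choose_one_right, add_comm (k.choose 2) k]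

/-- Limit `N → ∞` of the finite form: the Gaussian coefficients are bounded and tend to `1 / (Q;
Q)_∞`. The power `y^n` is paired with `x^(n+1)` to match the factor `1 - a^i q^((2n+1)i)` of
`QTerm`. -/
theorem tripleProduct {x y : ℂ} (hQ : ‖x * y‖ < 1) :
    qPochInf x (x * y) * qPochInf y (x * y) * qPochInf (x * y) (x * y)
      = ∑' n : ℕ, (-1) ^ n * ((x * y) ^ n.choose 2 * y ^ n
          - (x * y) ^ (n.choose 2 + n) * x ^ (n + 1)) := by
  set Q := x * y
  have hne := qPochInf_ne_zero hQ (self_pow_mul_ne_one hQ)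
  obtain ⟨C, hC0, hC⟩ := exists_norm_centralGauss_le hQ
  have hx := summable_tripleProduct_term hQ x
  have hy := summable_tripleProduct_term hQ y
  have lim1 : Tendsto (fun N => qPoch x Q N * qPoch y Q N) atTop
      (𝓝 (qPochInf x Q * qPochInf y Q)) := (tendsto_qPoch x hQ).mul (tendsto_qPoch y hQ)
  have lim2 : Tendsto (fun N => ∑' k : ℕ, (-1) ^ (k + 1) * Q ^ (k.choose 2 + k)
      * centralGauss Q N (k + 1) * (x ^ (k + 1) + y ^ (k + 1))) atTop
      (𝓝 (∑' k : ℕ, (-1) ^ (k + 1) * Q ^ (k.choose 2 + k)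
      * (qPochInf Q Q)⁻¹ * (x ^ (k + 1) + y ^ (k + 1)))) := by
    refine tendsto_tsum_of_dominated_convergence ((hx.norm.add hy.norm).mul_left C)
      (fun k => ((tendsto_centralGauss hQ (k + 1)).const_mul _).mul_const _)
      (Eventually.of_forall fun N k => ?_)
    have e : (-1) ^ (k + 1) * Q ^ (k.choose 2 + k) * centralGauss Q N (k + 1)
        * (x ^ (k + 1) + y ^ (k + 1)) = centralGauss Q N (k + 1)
        * ((-1) ^ (k + 1) * Q ^ (k.choose 2 + k) * x ^ (k + 1)
          + (-1) ^ (k + 1) * Q ^ (k.choose 2 + k) * y ^ (k + 1)) := by ring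
    rw [e, norm_mul]
    exact mul_le_mul (hC _ _) (norm_add_le _ _) (norm_nonneg _) hC0
  have lim3 := (tendsto_centralGauss hQ 0).add lim2
  have hfin : ∀ N, qPoch x Q N * qPoch y Q N = centralGauss Q N 0 + ∑' k : ℕ, (-1) ^ (k + 1)
      * Q ^ (k.choose 2 + k) * centralGauss Q N (k + 1) * (x ^ (k + 1) + y ^ (k + 1)) := fun N => by
    rw [finite_tripleProduct hQ N N le_rfl, tsum_eq_sum (s := Finset.range N)]
    intro k hk
    rw [centralGauss_of_lt Q (by simpa [Nat.lt_succ_iff] using hk)]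
    ring
  rw [tendsto_nhds_unique lim1 (lim3.congr fun N => (hfin N).symm)]
  have e1 : ∀ k : ℕ, (-1) ^ (k + 1) * Q ^ (k.choose 2 + k) * (qPochInf Q Q)⁻¹
      * (x ^ (k + 1) + y ^ (k + 1)) = (qPochInf Q Q)⁻¹
      * ((-1) ^ (k + 1) * Q ^ (k.choose 2 + k) * x ^ (k + 1)
        + (-1) ^ (k + 1) * Q ^ (k.choose 2 + k) * y ^ (k + 1)) := fun k => by ring
  have e2 : ∀ n : ℕ, (-1) ^ n * (Q ^ n.choose 2 * y ^ n - Q ^ (n.choose 2 + n) * x ^ (n + 1))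
      = (-1) ^ n * Q ^ n.choose 2 * y ^ n
        + (-1) ^ (n + 1) * Q ^ (n.choose 2 + n) * x ^ (n + 1) := fun n => by ring
  have e3 : ∑' n : ℕ, (-1) ^ n * Q ^ n.choose 2 * y ^ n
      = 1 + ∑' k : ℕ, (-1) ^ (k + 1) * Q ^ (k.choose 2 + k) * y ^ (k + 1) := by
    rw [(summable_theta hQ y).tsum_eq_zero_add]
    simp [Nat.choose_succ_succ' _ 1, add_comm]
  simp only [e1, e2]
  rw [tsum_mul_left, hx.tsum_add hy, (summable_theta hQ y).tsum_add hx, e3]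
  field_simp
  ring

/-! ### Double series: convergence and the limit along `a q^m`. -/

/-- The common shape of the terms of the double series. -/
noncomputable def doubleTerm (a q : ℂ) (l : ℕ) (w : ℂ) (L n r : ℕ) : ℂ :=
  a ^ (2 * n + 4 * r) * q ^ (2 * n ^ 2 + 4 * n * r + 4 * r ^ 2 + l) * w
    / (qPoch (-a * q) q L * qPoch (q ^ 2) (q ^ 2) r * qPoch (q ^ 2) (q ^ 2) n)

/-- The quadratic exponent dominates `n.choose 2 + r.choose 2`, and the majorant does not depend on
`m`, `l` or `L`. It thus serves both absolute convergence at `a` and dominated convergence along `a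
q^m`. -/
theorem exists_norm_doubleTerm_le {a q : ℂ} (hq : ‖q‖ < 1) (ha : ∀ j : ℕ, -a * q * q ^ j ≠ 1) :
    ∃ C : ℝ, 0 ≤ C ∧ ∀ (m l : ℕ) (w : ℂ) (L n r : ℕ),
      ‖doubleTerm (a * q ^ m) q l w L n r‖
        ≤ C * ‖w‖ * (((‖a‖ ^ 2) ^ n * ‖q‖ ^ n.choose 2) * ((‖a‖ ^ 4) ^ r * ‖q‖ ^ r.choose 2)) := by
  obtain ⟨C₁, h1, hC₁⟩ := exists_norm_inv_qPoch_le hq ha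
  have hq2 : ‖q ^ 2‖ < 1 := norm_pow_lt_one hq two_ne_zero
  obtain ⟨C₂, h2, hC₂⟩ := exists_norm_inv_qPoch_le hq2 (self_pow_mul_ne_one hq2)
  have hC₂' : ∀ n, ‖(qPoch (q ^ 2) (q ^ 2) n)⁻¹‖ ≤ C₂ := fun n => by simpa using hC₂ 0 n
  refine ⟨C₁ * C₂ * C₂, by positivity, fun m l w L n r => ?_⟩
  have e : doubleTerm (a * q ^ m) q l w L n r
      = ((qPoch (-a * q * q ^ m) q L)⁻¹ * (qPoch (q ^ 2) (q ^ 2) r)⁻¹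
          * (qPoch (q ^ 2) (q ^ 2) n)⁻¹) * w
        * ((a * q ^ m) ^ (2 * n + 4 * r) * q ^ (2 * n ^ 2 + 4 * n * r + 4 * r ^ 2 + l)) := by
    rw [doubleTerm, show -(a * q ^ m) * q = -a * q * q ^ m by ring, div_eq_mul_inv, mul_inv,
      mul_inv]
    ring
  rw [e, norm_mul, norm_mul, norm_mul, norm_mul]
  have hx : ‖(a * q ^ m) ^ (2 * n + 4 * r) * q ^ (2 * n ^ 2 + 4 * n * r + 4 * r ^ 2 + l)‖
      ≤ ((‖a‖ ^ 2) ^ n * ‖q‖ ^ n.choose 2) * ((‖a‖ ^ 4) ^ r * ‖q‖ ^ r.choose 2) := by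
    have h3 : ‖a * q ^ m‖ ≤ ‖a‖ := by
      rw [norm_mul, norm_pow]
      exact mul_le_of_le_one_right (norm_nonneg _) (pow_le_one₀ (norm_nonneg _) hq.le)
    have h4 : ‖q‖ ^ (2 * n ^ 2 + 4 * n * r + 4 * r ^ 2 + l)
        ≤ ‖q‖ ^ (n.choose 2 + r.choose 2) := by
      refine pow_le_pow_of_le_one (norm_nonneg _) hq.le ?_
      nlinarith [choose_two_le_sq n, choose_two_le_sq r, Nat.zero_le (n * r)]
    rw [norm_mul, norm_pow, norm_pow]
    calc _ ≤ ‖a‖ ^ (2 * n + 4 * r) * ‖q‖ ^ (n.choose 2 + r.choose 2) := by gcongr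
      _ = _ := by ring
  gcongr
  · exact hC₁ _ _
  · exact hC₂' _
  · exact hC₂' _

theorem summable_double_bound (A B : ℝ) (hA : 0 ≤ A) (hB : 0 ≤ B) {ρ : ℝ} (h0 : 0 ≤ ρ)
    (h1 : ρ < 1) : Summable fun p : ℕ × ℕ =>
      (A ^ p.1 * ρ ^ p.1.choose 2) * (B ^ p.2 * ρ ^ p.2.choose 2) :=
  (summable_pow_mul_pow_choose A h0 h1).mul_of_nonneg (summable_pow_mul_pow_choose B h0 h1)
    (fun _ => by positivity) (fun _ => by positivity)

theorem summable_doubleTerm {a q : ℂ} (hq : ‖q‖ < 1) (ha : ∀ j : ℕ, -a * q * q ^ j ≠ 1)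
    (l : ℕ → ℕ → ℕ) (w : ℕ → ℕ → ℂ) (L : ℕ → ℕ → ℕ) {W : ℝ} (hw : ∀ n r, ‖w n r‖ ≤ W) :
    Summable fun p : ℕ × ℕ =>
      doubleTerm a q (l p.1 p.2) (w p.1 p.2) (L p.1 p.2) p.1 p.2 := by
  obtain ⟨C, h0, hC⟩ := exists_norm_doubleTerm_le hq ha
  refine Summable.of_norm_bounded ((summable_double_bound (‖a‖ ^ 2) (‖a‖ ^ 4) (by positivity)
    (by positivity) (norm_nonneg q) hq).mul_left (C * W)) fun p => ?_
  have := hC 0 (l p.1 p.2) (w p.1 p.2) (L p.1 p.2) p.1 p.2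
  rw [pow_zero, mul_one] at this
  refine this.trans ?_
  gcongr
  exact hw _ _

/-- The linear part of the exponent of `q` in `F124Term`. -/
def linExp (i n r : ℕ) : ℕ :=
  if i ≤ 2 then 2 * n + 4 * r else if i ≤ 4 then 2 * r else 0

/-- The extra factor in the numerator of `F124Term`. -/
noncomputable def numFactor (i : ℕ) (a q : ℂ) (n r : ℕ) : ℂ :=
  if i = 3 then 1 + a * q ^ (2 * n + 2 * r + 1) else 1

/-- The length of the factorial `(-a q; q)` in the denominator of `F124Term`. -/
def denLength (i r : ℕ) : ℕ := if i = 1 ∨ i = 3 then 2 * r + 1 else 2 * r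

theorem F124Term_eq_doubleTerm {i : ℕ} (hi : i ∈ Finset.Icc 1 5) (a q : ℂ) (n r : ℕ) :
    F124Term i a q n r
      = doubleTerm a q (linExp i n r) (numFactor i a q n r) (denLength i r) n r := by
  rw [Finset.mem_Icc] at hi
  obtain ⟨h1, h2⟩ := hi
  interval_cases i <;> simp [F124Term, doubleTerm, linExp, numFactor, denLength, add_assoc]

theorem norm_numFactor_le (i : ℕ) {a q : ℂ} {A : ℝ} (ha : ‖a‖ ≤ A) (hq : ‖q‖ < 1) (n r : ℕ) :
    ‖numFactor i a q n r‖ ≤ 1 + A := by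
  have hA : 0 ≤ A := (norm_nonneg a).trans ha
  unfold numFactor
  split_ifs
  · refine (norm_add_le _ _).trans ?_
    rw [norm_one, norm_mul, norm_pow]
    gcongr
    exact (mul_le_of_le_one_right (norm_nonneg _) (pow_le_one₀ (norm_nonneg _) hq.le)).trans ha
  · simpa using hA

theorem summable_F124Term {a q : ℂ} (hq : ‖q‖ < 1) (ha : ∀ j : ℕ, -a * q * q ^ j ≠ 1) {i : ℕ}
    (hi : i ∈ Finset.Icc 1 5) : Summable fun p : ℕ × ℕ => F124Term i a q p.1 p.2 := by
  simp only [F124Term_eq_doubleTerm hi]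
  exact summable_doubleTerm hq ha (linExp i) (numFactor i a q) (fun _ r => denLength i r)
    fun n r => norm_numFactor_le i le_rfl hq n r

theorem F124Term_zero {i : ℕ} (hi : i ∈ Finset.Icc 1 5) (q : ℂ) (n r : ℕ) :
    F124Term i 0 q n r = if (n, r) = (0, 0) then 1 else 0 := by
  rw [F124Term_eq_doubleTerm hi]
  split_ifs with h
  · obtain ⟨rfl, rfl⟩ := Prod.mk.injEq .. ▸ h
    rw [Finset.mem_Icc] at hi
    obtain ⟨h1, h2⟩ := hi
    interval_cases i <;> simp [doubleTerm, linExp, numFactor, denLength, qPoch]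
  · have : 2 * n + 4 * r ≠ 0 := fun h' => h (by ext <;> simp <;> omega)
    rw [doubleTerm, zero_pow this]
    simp

theorem F124_zero {i : ℕ} (hi : i ∈ Finset.Icc 1 5) (q : ℂ) : F124 i 0 q = 1 := by
  unfold F124
  rw [tsum_eq_single (0, 0) fun p hp => by rw [F124Term_zero hi, if_neg (by simpa using hp)]]
  rw [F124Term_zero hi, if_pos rfl]

theorem tendsto_mul_pow_zero (a : ℂ) {q : ℂ} (hq : ‖q‖ < 1) :
    Tendsto (fun m : ℕ => a * q ^ m) atTop (𝓝 0) := by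
  simpa using (tendsto_pow_atTop_nhds_zero_of_norm_lt_one hq).const_mul a

theorem norm_mul_pow_le (a : ℂ) {q : ℂ} (hq : ‖q‖ < 1) (m : ℕ) : ‖a * q ^ m‖ ≤ ‖a‖ := by
  rw [norm_mul, norm_pow]
  exact mul_le_of_le_one_right (norm_nonneg _) (pow_le_one₀ (norm_nonneg _) hq.le)

theorem tendsto_F124 {a q : ℂ} (hq : ‖q‖ < 1) (ha : ∀ j : ℕ, -a * q * q ^ j ≠ 1) {i : ℕ}
    (hi : i ∈ Finset.Icc 1 5) :
    Tendsto (fun m : ℕ => F124 i (a * q ^ m) q) atTop (𝓝 1) := by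
  obtain ⟨C, h0, hC⟩ := exists_norm_doubleTerm_le hq ha
  rw [← F124_zero hi q]
  refine tendsto_tsum_of_dominated_convergence ((summable_double_bound (‖a‖ ^ 2) (‖a‖ ^ 4)
    (by positivity) (by positivity) (norm_nonneg q) hq).mul_left (C * (1 + ‖a‖)))
    (fun p => ?_) (Eventually.of_forall fun m p => ?_)
  · have hq2 : ‖q ^ 2‖ < 1 := norm_pow_lt_one hq two_ne_zero
    have hp := qPoch_ne_zero (self_pow_mul_ne_one hq2)
    have hc : ContinuousAt (fun z => F124Term i z q p.1 p.2) 0 := by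
      simp only [F124Term_eq_doubleTerm hi]
      unfold doubleTerm numFactor
      refine ContinuousAt.div ?_ ?_ ?_
      · split_ifs <;> fun_prop
      · have := (continuous_qPoch q (denLength i p.2)).comp
          (show Continuous fun z : ℂ => -z * q by fun_prop)
        exact ((this.mul continuous_const).mul continuous_const).continuousAt
      · simp [qPoch_ne_zero (x := 0) (q := q) (by simp), hp]
    exact hc.tendsto.comp (tendsto_mul_pow_zero a hq)
  · rw [F124Term_eq_doubleTerm hi]
    refine (hC _ _ _ _ _ _).trans ?_
    gcongr
    exact norm_numFactor_le i (norm_mul_pow_le a hq m) hq _ _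

/-! ### The `q`-difference equations of the double series. -/

theorem one_add_mul_qPoch (a q : ℂ) (n : ℕ) :
    (1 + a * q) * qPoch (-(a * q) * q) q n = qPoch (-a * q) q (n + 1) := by
  rw [qPoch_succ', show -a * q * q = -(a * q) * q by ring]
  ring

theorem one_add_ne_zero_of_ne {a q : ℂ} (ha : ∀ j : ℕ, -a * q * q ^ j ≠ 1) (m : ℕ) :
    1 + a * q ^ (m + 1) ≠ 0 := fun h => ha m (by linear_combination -h)

theorem shift_ne_one {a q : ℂ} (ha : ∀ j : ℕ, -a * q * q ^ j ≠ 1) (m j : ℕ) :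
    -(a * q ^ m) * q * q ^ j ≠ 1 := by
  have := ha (m + j)
  rwa [show -(a * q ^ m) * q * q ^ j = -a * q * q ^ (m + j) by ring]

/-- Rewriting a term of the double series at `a q` in terms of `a`. -/
theorem doubleTerm_shift {a q : ℂ} (l : ℕ) (w : ℂ) (L n r : ℕ) :
    1 / (1 + a * q) * doubleTerm (a * q) q l w L n r
      = doubleTerm a q (2 * n + 4 * r + l) w (L + 1) n r := by
  rw [doubleTerm, doubleTerm, ← one_add_mul_qPoch, div_mul_div_comm, one_mul]
  congr 1
  · ring
  · ring

theorem F124_one {a q : ℂ} : F124 1 a q = 1 / (1 + a * q) * F124 5 (a * q) q := by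
  unfold F124
  rw [← tsum_mul_left]
  refine tsum_congr fun p => ?_
  rw [F124Term_eq_doubleTerm (by simp), F124Term_eq_doubleTerm (by simp),
    show numFactor 5 (a * q) q p.1 p.2 = 1 by simp [numFactor], doubleTerm_shift]
  simp [linExp, numFactor, denLength]

theorem doubleTerm_eq_mul (a q : ℂ) (l : ℕ) (w : ℂ) (L n r : ℕ) :
    doubleTerm a q l w L n r = q ^ l * w * doubleTerm a q 0 1 L n r := by
  unfold doubleTerm
  ring

theorem doubleTerm_succ_length {a q : ℂ} (ha : ∀ j : ℕ, -a * q * q ^ j ≠ 1) (l : ℕ) (w : ℂ)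
    (L n r : ℕ) : doubleTerm a q l w L n r
      = (1 + a * q ^ (L + 1)) * doubleTerm a q l w (L + 1) n r := by
  have h := one_add_ne_zero_of_ne ha L
  rw [doubleTerm, doubleTerm, qPoch_succ,
    show 1 - -a * q * q ^ L = 1 + a * q ^ (L + 1) by ring, ← mul_div_assoc,
    show ∀ x y z w : ℂ, x * y * z * w = y * (x * z * w) from fun x y z w => by ring,
    mul_div_mul_left _ _ h]

theorem one_sub_mul_inv_qPoch_sq {q : ℂ} (hq : ‖q‖ < 1) (n : ℕ) :
    (1 - q ^ (2 * (n + 1))) * (qPoch (q ^ 2) (q ^ 2) (n + 1))⁻¹ = (qPoch (q ^ 2) (q ^ 2) n)⁻¹ := by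
  rw [inv_qPoch_self (norm_pow_lt_one hq two_ne_zero) n, ← pow_mul]

/-- The weight cancels the last factor of `(q²; q²)_{n+1}`, and the quadratic form grows by `4n + 4r
+ 2`. -/
theorem doubleTerm_succ_left {q : ℂ} (hq : ‖q‖ < 1) (a : ℂ) (l L n r : ℕ) :
    doubleTerm a q l (1 - q ^ (2 * (n + 1))) L (n + 1) r
      = a ^ 2 * doubleTerm a q (4 * n + 4 * r + 2 + l) 1 L n r := by
  simp only [doubleTerm, div_eq_mul_inv, mul_inv, ← one_sub_mul_inv_qPoch_sq hq n]
  ring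

theorem doubleTerm_succ_right {q : ℂ} (hq : ‖q‖ < 1) (a : ℂ) (l L n r : ℕ) :
    doubleTerm a q l (1 - q ^ (2 * (r + 1))) L n (r + 1)
      = a ^ 4 * doubleTerm a q (4 * n + 8 * r + 4 + l) 1 L n r := by
  simp only [doubleTerm, div_eq_mul_inv, mul_inv, ← one_sub_mul_inv_qPoch_sq hq r]
  ring

theorem norm_one_sub_pow_le {q : ℂ} (hq : ‖q‖ < 1) (m : ℕ) : ‖1 - q ^ m‖ ≤ 2 := by
  refine (norm_sub_le _ _).trans ?_
  rw [norm_one, norm_pow]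
  linarith [pow_le_one₀ (n := m) (norm_nonneg q) hq.le]

/-- Holds term by term: in `1 + aq^(2r+1)`, the factor that lengthens `(-aq; q)_{2r}`, the `1` gives
`F124 1` and the rest gives `F124 4` at `aq`. -/
theorem F124_two {a q : ℂ} (hq : ‖q‖ < 1) (ha : ∀ j : ℕ, -a * q * q ^ j ≠ 1) :
    F124 2 a q = F124 1 a q + a * q / (1 + a * q) * F124 4 (a * q) q := by
  have ha' : ∀ j : ℕ, -(a * q) * q * q ^ j ≠ 1 := by simpa using shift_ne_one ha 1
  have s1 := summable_F124Term hq ha (i := 1) (by simp)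
  have s4 := (summable_F124Term hq ha' (i := 4) (by simp)).mul_left (a * q / (1 + a * q))
  unfold F124
  rw [← tsum_mul_left, ← s1.tsum_add s4]
  refine tsum_congr fun ⟨n, r⟩ => ?_
  dsimp only
  rw [show ∀ z, a * q / (1 + a * q) * z = a * q * (1 / (1 + a * q) * z) from fun z => by ring]
  simp only [F124Term_eq_doubleTerm (show 1 ∈ Finset.Icc 1 5 by simp),
    F124Term_eq_doubleTerm (show 2 ∈ Finset.Icc 1 5 by simp),
    F124Term_eq_doubleTerm (show 4 ∈ Finset.Icc 1 5 by simp), linExp, numFactor, denLength,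
    doubleTerm_shift]
  norm_num
  rw [doubleTerm_succ_length ha _ _ (2 * r), doubleTerm_eq_mul,
    doubleTerm_eq_mul _ _ (2 * n + 4 * r + 2 * r)]
  ring

/-- The one equation needing shifts in both indices. `F124 3 - F124 2` splits into a part with `1 -
q^(2n)` and a part with `1 - q^(2r)`; `F124 3` at `aq` splits into a plain part and a part with `1 -
q^(2n)`. After shifting, the parts agree in pairs. -/
theorem F124_three {a q : ℂ} (hq : ‖q‖ < 1) (ha : ∀ j : ℕ, -a * q * q ^ j ≠ 1) :
    F124 3 a q = F124 2 a q + a ^ 2 * q ^ 2 / (1 + a * q) * F124 3 (a * q) q := by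
  have ha' : ∀ j : ℕ, -(a * q) * q * q ^ j ≠ 1 := by simpa using shift_ne_one ha 1
  have s2 := summable_F124Term hq ha (i := 2) (by simp)
  have sU := summable_doubleTerm hq ha (fun _ r => 2 * r) (fun n _ => 1 - q ^ (2 * n))
    (fun _ r => 2 * r + 1) (W := 2) fun n _ => norm_one_sub_pow_le hq _
  have sV := summable_doubleTerm hq ha (fun n r => 2 * n + 2 * r) (fun _ r => 1 - q ^ (2 * r))
    (fun _ r => 2 * r) (W := 2) fun _ r => norm_one_sub_pow_le hq _
  have sU' := (summable_doubleTerm hq ha (fun n r => 4 * n + 4 * r + 2 + 2 * r) (fun _ _ => 1)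
    (fun _ r => 2 * r + 1) (W := 1) (by simp)).mul_left (a ^ 2)
  have sW := (summable_doubleTerm hq ha (fun n r => 2 * n + 4 * r + 2 * r)
    (fun n _ => 1 - q ^ (2 * n)) (fun _ r => 2 * r + 2) (W := 2)
    fun n _ => norm_one_sub_pow_le hq _).mul_left (a ^ 2 * q ^ 2)
  have e1 : F124 3 a q = F124 2 a q
      + (∑' p : ℕ × ℕ, doubleTerm a q (2 * p.2) (1 - q ^ (2 * p.1)) (2 * p.2 + 1) p.1 p.2
      + ∑' p : ℕ × ℕ, doubleTerm a q (2 * p.1 + 2 * p.2) (1 - q ^ (2 * p.2)) (2 * p.2)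
          p.1 p.2) := by
    unfold F124
    rw [← sU.tsum_add sV, ← s2.tsum_add (sU.add sV)]
    refine tsum_congr fun ⟨n, r⟩ => ?_
    simp only [F124Term_eq_doubleTerm (show 2 ∈ Finset.Icc 1 5 by simp),
      F124Term_eq_doubleTerm (show 3 ∈ Finset.Icc 1 5 by simp), linExp, numFactor, denLength]
    norm_num
    rw [doubleTerm_succ_length ha _ _ (2 * r), doubleTerm_succ_length ha _ _ (2 * r),
      doubleTerm_eq_mul, doubleTerm_eq_mul _ _ (2 * n + 4 * r),
      doubleTerm_eq_mul _ _ (2 * r) (1 - q ^ (2 * n)), doubleTerm_eq_mul _ _ (2 * n + 2 * r)]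
    ring
  have e2 : a ^ 2 * q ^ 2 / (1 + a * q) * F124 3 (a * q) q
      = ∑' p : ℕ × ℕ, a ^ 2 * doubleTerm a q (4 * p.1 + 4 * p.2 + 2 + 2 * p.2) 1 (2 * p.2 + 1)
          p.1 p.2
        + ∑' p : ℕ × ℕ, a ^ 2 * q ^ 2 * doubleTerm a q (2 * p.1 + 4 * p.2 + 2 * p.2)
          (1 - q ^ (2 * p.1)) (2 * p.2 + 2) p.1 p.2 := by
    unfold F124
    rw [← sU'.tsum_add sW, ← tsum_mul_left]
    refine tsum_congr fun ⟨n, r⟩ => ?_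
    dsimp only
    rw [show ∀ z, a ^ 2 * q ^ 2 / (1 + a * q) * z = a ^ 2 * q ^ 2 * (1 / (1 + a * q) * z) from
      fun z => by ring]
    simp only [F124Term_eq_doubleTerm (show 3 ∈ Finset.Icc 1 5 by simp), linExp, numFactor,
      denLength, doubleTerm_shift]
    norm_num
    rw [doubleTerm_succ_length ha _ _ (2 * r + 1), doubleTerm_eq_mul,
      doubleTerm_eq_mul _ _ (4 * n + 4 * r + 2 + 2 * r),
      doubleTerm_eq_mul _ _ (2 * n + 4 * r + 2 * r) (1 - q ^ (2 * n))]
    ring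
  rw [e1, e2, tsum_prod_shift_left
      (g := fun p : ℕ × ℕ => doubleTerm a q (2 * p.2) (1 - q ^ (2 * p.1)) (2 * p.2 + 1) p.1 p.2)
      fun r => by simp [doubleTerm],
    tsum_prod_shift_right
      (g := fun p : ℕ × ℕ => doubleTerm a q (2 * p.1 + 2 * p.2) (1 - q ^ (2 * p.2)) (2 * p.2)
          p.1 p.2) fun n => by simp [doubleTerm],
    tsum_prod_shift_left
      (g := fun p : ℕ × ℕ => a ^ 2 * q ^ 2 * doubleTerm a q (2 * p.1 + 4 * p.2 + 2 * p.2)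
          (1 - q ^ (2 * p.1)) (2 * p.2 + 2) p.1 p.2) fun r => by simp [doubleTerm]]
  congr 2
  · exact tsum_congr fun p => doubleTerm_succ_left hq _ _ _ _ _
  -- Here a shift in `r` on the left meets a shift in `n` on the right; both give `a^4 q^(6n+10r+6)`
  -- times the basic term with denominator length `2r + 2`.
  · refine tsum_congr fun ⟨n, r⟩ => ?_
    dsimp only
    rw [doubleTerm_succ_left hq, doubleTerm_succ_right hq, doubleTerm_eq_mul,
      doubleTerm_eq_mul _ _ (4 * n + 4 * r + 2 + _)]
    ring_nf

/-- Over the common length `2r + 1`, the difference of the numerators is `a q^(4r+1) (1 - q^(2n))`.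
-/
theorem F124_four {a q : ℂ} (hq : ‖q‖ < 1) (ha : ∀ j : ℕ, -a * q * q ^ j ≠ 1) :
    F124 4 a q = F124 3 a q + a ^ 3 * q ^ 3 / (1 + a * q) * F124 2 (a * q) q := by
  have s3 := summable_F124Term hq ha (i := 3) (by simp)
  have sU := (summable_doubleTerm hq ha (fun _ r => 4 * r) (fun n _ => 1 - q ^ (2 * n))
    (fun _ r => 2 * r + 1) (W := 2) fun n _ => norm_one_sub_pow_le hq _).mul_left (a * q)
  have e1 : F124 4 a q = F124 3 a q + ∑' p : ℕ × ℕ,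
      a * q * doubleTerm a q (4 * p.2) (1 - q ^ (2 * p.1)) (2 * p.2 + 1) p.1 p.2 := by
    unfold F124
    rw [← s3.tsum_add sU]
    refine tsum_congr fun ⟨n, r⟩ => ?_
    simp only [F124Term_eq_doubleTerm (show 3 ∈ Finset.Icc 1 5 by simp),
      F124Term_eq_doubleTerm (show 4 ∈ Finset.Icc 1 5 by simp), linExp, numFactor, denLength]
    norm_num
    rw [doubleTerm_succ_length ha _ _ (2 * r), doubleTerm_eq_mul,
      doubleTerm_eq_mul _ _ (2 * r) (1 + _), doubleTerm_eq_mul _ _ (4 * r)]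
    ring
  rw [e1, tsum_prod_shift_left fun r => by simp [doubleTerm]]
  congr 1
  unfold F124
  rw [← tsum_mul_left]
  refine tsum_congr fun ⟨n, r⟩ => ?_
  dsimp only
  rw [show ∀ z, a ^ 3 * q ^ 3 / (1 + a * q) * z = a ^ 3 * q ^ 3 * (1 / (1 + a * q) * z) from
    fun z => by ring, doubleTerm_succ_left hq]
  simp only [F124Term_eq_doubleTerm (show 2 ∈ Finset.Icc 1 5 by simp), linExp, numFactor,
    denLength, doubleTerm_shift]
  norm_num
  rw [doubleTerm_eq_mul, doubleTerm_eq_mul _ _ (2 * n + 4 * r + _)]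
  ring

theorem F124_five {a q : ℂ} (hq : ‖q‖ < 1) (ha : ∀ j : ℕ, -a * q * q ^ j ≠ 1) :
    F124 5 a q = F124 4 a q + a ^ 4 * q ^ 4 / (1 + a * q) * F124 1 (a * q) q := by
  have s4 := summable_F124Term hq ha (i := 4) (by simp)
  have sU := summable_doubleTerm hq ha (fun _ _ => 0) (fun _ r => 1 - q ^ (2 * r))
    (fun _ r => 2 * r) (W := 2) fun _ r => norm_one_sub_pow_le hq _
  have e1 : F124 5 a q = F124 4 a q + ∑' p : ℕ × ℕ,
      doubleTerm a q 0 (1 - q ^ (2 * p.2)) (2 * p.2) p.1 p.2 := by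
    unfold F124
    rw [← s4.tsum_add sU]
    refine tsum_congr fun ⟨n, r⟩ => ?_
    simp only [F124Term_eq_doubleTerm (show 4 ∈ Finset.Icc 1 5 by simp),
      F124Term_eq_doubleTerm (show 5 ∈ Finset.Icc 1 5 by simp), linExp, numFactor, denLength]
    norm_num
    rw [doubleTerm_eq_mul _ _ (2 * r), doubleTerm_eq_mul _ _ 0 (1 - _)]
    ring
  rw [e1, tsum_prod_shift_right fun n => by simp [doubleTerm]]
  congr 1
  unfold F124
  rw [← tsum_mul_left]
  refine tsum_congr fun ⟨n, r⟩ => ?_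
  dsimp only
  rw [show ∀ z, a ^ 4 * q ^ 4 / (1 + a * q) * z = a ^ 4 * q ^ 4 * (1 / (1 + a * q) * z) from
    fun z => by ring, doubleTerm_succ_right hq]
  simp only [F124Term_eq_doubleTerm (show 1 ∈ Finset.Icc 1 5 by simp), linExp, numFactor,
    denLength, doubleTerm_shift]
  norm_num
  rw [doubleTerm_eq_mul, doubleTerm_eq_mul _ _ (2 * n + 4 * r + _)]
  ring_nf

/-! ### The series `Q`: convergence, limit and `q`-difference equations. -/

theorem choose_two_le_QExponent (i n : ℕ) : n.choose 2 ≤ QExponent 1 2 4 i n := by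
  have := choose_two_le_triangle n
  unfold QExponent
  rw [one_mul]
  omega

theorem exists_norm_QTerm_le (i : ℕ) (a : ℂ) {q : ℂ} (hq : ‖q‖ < 1) :
    ∃ C : ℝ, ∀ m n, ‖QTerm 1 2 4 i (a * q ^ m) q n‖
      ≤ C * ((‖a‖ ^ 5) ^ n * ‖q‖ ^ n.choose 2) := by
  obtain ⟨C₁, h1, hC₁⟩ := exists_norm_inv_qPoch_le hq (self_pow_mul_ne_one hq)
  have hC₁' : ∀ n, ‖(qPoch q q n)⁻¹‖ ≤ C₁ := fun n => by simpa using hC₁ 0 n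
  refine ⟨(1 + ‖a‖ ^ i) * Real.exp (‖a‖ / (1 - ‖q‖)) * C₁, fun m n => ?_⟩
  have hm := norm_mul_pow_le a hq m
  have e : QTerm 1 2 4 i (a * q ^ m) q n = (1 - (a * q ^ m) ^ i * q ^ ((2 * n + 1) * 1 * i))
      * qPoch (a * q ^ (m + 1)) q n * (qPoch q q n)⁻¹
      * ((-1) ^ n * ((a * q ^ m) ^ (5 * n) * q ^ QExponent 1 2 4 i n)) := by
    rw [QTerm, pow_one, div_eq_mul_inv, show a * q ^ m * q = a * q ^ (m + 1) by ring]
    norm_num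
    ring
  rw [e]
  simp only [norm_mul, norm_pow, norm_neg, norm_one, one_pow, one_mul]
  have hz : ‖1 - (a * q ^ m) ^ i * q ^ ((2 * n + 1) * 1 * i)‖ ≤ 1 + ‖a‖ ^ i := by
    refine (norm_sub_le _ _).trans ?_
    rw [norm_one, norm_mul, norm_pow, norm_pow]
    gcongr
    calc _ ≤ ‖a‖ ^ i * 1 := by
          gcongr
          exact pow_le_one₀ (norm_nonneg _) hq.le
      _ = _ := mul_one _
  have hp : ‖qPoch (a * q ^ (m + 1)) q n‖ ≤ Real.exp (‖a‖ / (1 - ‖q‖)) := by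
    refine (norm_qPoch_le _ hq n).trans (Real.exp_le_exp.mpr ?_)
    exact div_le_div_of_nonneg_right (norm_mul_pow_le a hq _) (by linarith)
  have hpow : (‖a‖ * ‖q‖ ^ m) ^ (5 * n) ≤ (‖a‖ ^ 5) ^ n := by
    rw [← pow_mul]
    refine pow_le_pow_left₀ (by positivity) ?_ _
    simpa using hm
  have hqp : ‖q‖ ^ QExponent 1 2 4 i n ≤ ‖q‖ ^ n.choose 2 :=
    pow_le_pow_of_le_one (norm_nonneg _) hq.le (choose_two_le_QExponent i n)
  gcongr
  exact hC₁' n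

theorem summable_QTerm (i : ℕ) (a : ℂ) {q : ℂ} (hq : ‖q‖ < 1) :
    Summable (QTerm 1 2 4 i a q) := by
  obtain ⟨C, hC⟩ := exists_norm_QTerm_le i a hq
  refine Summable.of_norm_bounded
    ((summable_pow_mul_pow_choose (‖a‖ ^ 5) (norm_nonneg q) hq).mul_left C) fun n => ?_
  simpa using hC 0 n

theorem tendsto_tsum_QTerm {i : ℕ} (hi : 1 ≤ i) (a : ℂ) {q : ℂ} (hq : ‖q‖ < 1) :
    Tendsto (fun m : ℕ => ∑' n, QTerm 1 2 4 i (a * q ^ m) q n) atTop (𝓝 1) := by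
  obtain ⟨C, hC⟩ := exists_norm_QTerm_le i a hq
  have h0 : ∑' n, QTerm 1 2 4 i 0 q n = 1 := by
    rw [tsum_eq_single 0 fun n hn => by simp [QTerm, hn]]
    simp [QTerm, QExponent, qPoch, Nat.one_le_iff_ne_zero.mp hi]
  rw [← h0]
  refine tendsto_tsum_of_dominated_convergence
    ((summable_pow_mul_pow_choose (‖a‖ ^ 5) (norm_nonneg q) hq).mul_left C) (fun n => ?_)
    (Eventually.of_forall hC)
  have hc : Continuous fun z => QTerm 1 2 4 i z q n := by
    unfold QTerm
    have := (continuous_qPoch (q ^ 1) n).comp (show Continuous fun z : ℂ => z * q ^ 1 by fun_prop)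
    refine Continuous.div_const (Continuous.mul (by fun_prop) this) _
  exact (hc.tendsto 0).comp (tendsto_mul_pow_zero a hq)

theorem QTerm_eq {s t : ℕ} (h : s + t = 5) (a q : ℂ) (n : ℕ) :
    QTerm 1 2 4 s a q n = (-1) ^ n * a ^ (5 * n) * q ^ (5 * n ^ 2 + t * n + n * (n + 1) / 2)
      * (1 - a ^ s * q ^ ((2 * n + 1) * s)) * qPoch (a * q) q n * (qPoch q q n)⁻¹ := by
  obtain rfl : t = 5 - s := by omega
  simp [QTerm, QExponent, div_eq_mul_inv]

/-- The difference of the `n`-th terms is `U n - U (n + 1)`, where `U` carries the factor `1 - q^n`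
and so vanishes at `0`. The shifted series enters through `(aq; q)_n (1 - aq^(n+1)) = (1 - aq)(aq²;
q)_n`. -/
theorem tsum_QTerm_succ {s t : ℕ} (h : s + t = 4) (a : ℂ) {q : ℂ} (hq : ‖q‖ < 1) :
    ∑' n, QTerm 1 2 4 (s + 1) a q n = ∑' n, QTerm 1 2 4 s a q n
      + a ^ s * q ^ s * (1 - a * q) * ∑' n, QTerm 1 2 4 (t + 1) (a * q) q n := by
  have h1 : ∀ n, QTerm 1 2 4 (s + 1) a q n - QTerm 1 2 4 s a q n
      - a ^ s * q ^ s * (1 - a * q) * QTerm 1 2 4 (t + 1) (a * q) q n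
      = (-1) ^ n * a ^ (5 * n) * q ^ (5 * n ^ 2 + t * n + n * (n + 1) / 2) * (1 - q ^ n)
          * qPoch (a * q) q n * (qPoch q q n)⁻¹
        - (-1) ^ (n + 1) * a ^ (5 * (n + 1))
          * q ^ (5 * (n + 1) ^ 2 + t * (n + 1) + (n + 1) * (n + 1 + 1) / 2) * (1 - q ^ (n + 1))
          * qPoch (a * q) q (n + 1) * (qPoch q q (n + 1))⁻¹ := fun n => by
    rw [QTerm_eq (show s + 1 + t = 5 by omega), QTerm_eq (show s + (t + 1) = 5 by omega),
      QTerm_eq (show t + 1 + s = 5 by omega), triangle_succ]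
    have e1 : (1 - a * q) * qPoch (a * q * q) q n = qPoch (a * q) q n * (1 - a * q ^ (n + 1)) := by
      rw [← qPoch_succ', qPoch_succ]
      ring
    have e2 := inv_qPoch_self hq n
    have e3 : (1 - q ^ (n + 1)) * qPoch (a * q) q (n + 1) * (qPoch q q (n + 1))⁻¹
        = qPoch (a * q) q n * (1 - a * q ^ (n + 1)) * (qPoch q q n)⁻¹ := by
      rw [e2, qPoch_succ]
      ring
    -- Natural-number division is opaque to `ring`; only the increment given by `triangle_succ` is
    -- needed.
    generalize n * (n + 1) / 2 = T at *
    obtain rfl : s = 4 - t := by omega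
    have ht : t ≤ 4 := by omega
    have e4 : ∀ x y : ℂ, a ^ (4 - t) * q ^ (4 - t) * (1 - a * q) * (x * y
        * qPoch (a * q * q) q n * (qPoch q q n)⁻¹) = a ^ (4 - t) * q ^ (4 - t) * x * y
        * (qPoch (a * q) q n * (1 - a * q ^ (n + 1))) * (qPoch q q n)⁻¹ := fun x y => by
      rw [← e1]
      ring
    have e5 : ∀ x : ℂ, x * (1 - q ^ (n + 1)) * qPoch (a * q) q (n + 1) * (qPoch q q (n + 1))⁻¹
        = x * (qPoch (a * q) q n * (1 - a * q ^ (n + 1)) * (qPoch q q n)⁻¹) := fun x => by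
      rw [← e3]
      ring
    rw [e4, e5]
    interval_cases t <;> norm_num <;> ring
  have sa := summable_QTerm (s + 1) a hq
  have sb := summable_QTerm s a hq
  have sc := (summable_QTerm (t + 1) (a * q) hq).mul_left (a ^ s * q ^ s * (1 - a * q))
  have hU : Summable fun n : ℕ => (-1) ^ n * a ^ (5 * n)
      * q ^ (5 * n ^ 2 + t * n + n * (n + 1) / 2) * (1 - q ^ n)
      * qPoch (a * q) q n * (qPoch q q n)⁻¹ := by
    obtain ⟨C₁, h1, hC₁⟩ := exists_norm_inv_qPoch_le hq (self_pow_mul_ne_one hq)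
    refine Summable.of_norm_bounded ((summable_pow_mul_pow_choose (‖a‖ ^ 5) (norm_nonneg q)
      hq).mul_left (2 * Real.exp (‖a * q‖ / (1 - ‖q‖)) * C₁)) fun n => ?_
    have e : (‖a‖ ^ 5) ^ n = ‖a‖ ^ (5 * n) := by rw [← pow_mul]
    have hqp : ‖q‖ ^ (5 * n ^ 2 + t * n + n * (n + 1) / 2) ≤ ‖q‖ ^ n.choose 2 :=
      pow_le_pow_of_le_one (norm_nonneg _) hq.le
        ((choose_two_le_triangle n).trans (Nat.le_add_left _ _))
    calc _ = ‖1 - q ^ n‖ * ‖qPoch (a * q) q n‖ * ‖(qPoch q q n)⁻¹‖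
          * ((‖a‖ ^ 5) ^ n * ‖q‖ ^ (5 * n ^ 2 + t * n + n * (n + 1) / 2)) := by
          simp only [norm_mul, norm_pow, norm_neg, norm_one, one_pow, one_mul, e]
          ring
      _ ≤ _ := by
          gcongr
          · exact norm_one_sub_pow_le hq n
          · exact norm_qPoch_le _ hq n
          · simpa using hC₁ 0 n
  have h2 : ∑' n, (QTerm 1 2 4 (s + 1) a q n - QTerm 1 2 4 s a q n
      - a ^ s * q ^ s * (1 - a * q) * QTerm 1 2 4 (t + 1) (a * q) q n) = 0 := by
    simp only [h1]
    rw [hU.tsum_sub ((summable_nat_add_iff 1).mpr hU), sub_eq_zero]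
    exact tsum_shift (g := fun n : ℕ => (-1) ^ n * a ^ (5 * n)
      * q ^ (5 * n ^ 2 + t * n + n * (n + 1) / 2) * (1 - q ^ n)
      * qPoch (a * q) q n * (qPoch q q n)⁻¹) (by simp)
  rw [(sa.sub sb).tsum_sub sc, sa.tsum_sub sb, tsum_mul_left] at h2
  linear_combination h2

theorem Q_zero_index (a q : ℂ) : Q 1 2 4 0 a q = 0 := by
  simp [Q, QTerm]

theorem sq_shift_ne_one {a q : ℂ} (ha : ∀ j : ℕ, a ^ 2 * q ^ 2 * (q ^ 2) ^ j ≠ 1) (j : ℕ) :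
    -a * q * q ^ j ≠ 1 := fun h => ha j <| by
  rw [show a ^ 2 * q ^ 2 * (q ^ 2) ^ j = (-a * q * q ^ j) ^ 2 by ring, h, one_pow]

theorem sq_ne_one_shift {a q : ℂ} (ha : ∀ j : ℕ, a ^ 2 * q ^ 2 * (q ^ 2) ^ j ≠ 1) (m j : ℕ) :
    (a * q ^ m) ^ 2 * q ^ 2 * (q ^ 2) ^ j ≠ 1 := by
  have := ha (m + j)
  rwa [show (a * q ^ m) ^ 2 * q ^ 2 * (q ^ 2) ^ j = a ^ 2 * q ^ 2 * (q ^ 2) ^ (m + j) by ring]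

/-- The prefactor contributes `1 - a²q² = (1 - aq)(1 + aq)`, whose first factor cancels the one in
`tsum_QTerm_succ`. -/
theorem Q_succ {s t : ℕ} (h : s + t = 4) {a q : ℂ} (hq : ‖q‖ < 1)
    (ha : ∀ j : ℕ, a ^ 2 * q ^ 2 * (q ^ 2) ^ j ≠ 1) :
    Q 1 2 4 (s + 1) a q
      = Q 1 2 4 s a q + a ^ s * q ^ s / (1 + a * q) * Q 1 2 4 (t + 1) (a * q) q := by
  have hq2 : ‖q ^ 2‖ < 1 := norm_pow_lt_one hq two_ne_zero
  have hP : qPochInf (a ^ 2 * q ^ 2) (q ^ 2)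
      = (1 - a * q) * (1 + a * q) * qPochInf ((a * q) ^ 2 * q ^ 2) (q ^ 2) := by
    rw [qPochInf_eq_mul _ hq2 1, qPoch_succ, qPoch_zero, pow_zero, pow_one,
      show (a * q) ^ 2 * q ^ 2 = a ^ 2 * q ^ 2 * q ^ 2 by ring]
    ring
  have h0 := qPochInf_ne_zero hq2 ha
  rw [hP] at h0
  have h1 := left_ne_zero_of_mul (left_ne_zero_of_mul h0)
  have h2 := right_ne_zero_of_mul (left_ne_zero_of_mul h0)
  have h3 := right_ne_zero_of_mul h0
  simp only [Q]
  rw [tsum_QTerm_succ h a hq, hP]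
  field_simp

theorem tendsto_Q {i : ℕ} (hi : 1 ≤ i) {a q : ℂ} (hq : ‖q‖ < 1)
    (ha : ∀ j : ℕ, a ^ 2 * q ^ 2 * (q ^ 2) ^ j ≠ 1) :
    Tendsto (fun m : ℕ => Q 1 2 4 i (a * q ^ m) q) atTop (𝓝 1) := by
  have hq2 : ‖q ^ 2‖ < 1 := norm_pow_lt_one hq two_ne_zero
  have h1 := (tendsto_qPochInf_shift hq2 ha).inv₀ one_ne_zero
  have h2 := h1.mul (tendsto_tsum_QTerm hi a hq)
  rw [inv_one, one_mul] at h2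
  refine h2.congr fun m => ?_
  rw [Q, one_div, show (a * q ^ m) ^ 2 * q ^ 2 = a ^ 2 * q ^ 2 * (q ^ 2) ^ m by ring]

/-! ### Uniqueness of the solution of the system. -/

theorem F124_succ {s t : ℕ} (h : s + t = 4) {a q : ℂ} (hq : ‖q‖ < 1)
    (ha : ∀ j : ℕ, -a * q * q ^ j ≠ 1) :
    F124 (s + 1) a q
      = F124 s a q + a ^ s * q ^ s / (1 + a * q) * F124 (t + 1) (a * q) q := by
  obtain rfl : t = 4 - s := by omega
  have hs : s ≤ 4 := by omega
  interval_cases s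
  -- The default value `0` at index `0` makes the first equation the case `s = 0`, in parallel with
  -- `Q_zero_index`.
  · have : F124 0 a q = 0 := by simp [F124, F124Term]
    simpa [this] using F124_one
  · simpa using F124_two hq ha
  · simpa using F124_three hq ha
  · simpa using F124_four hq ha
  · simpa using F124_five hq ha

/-- The difference between `F124` and `Q`, as a vector indexed by `i - 1`. -/
noncomputable def diffVec (a q : ℂ) (i : Fin 5) : ℂ := F124 (i + 1) a q - Q 1 2 4 (i + 1) a q

/-- Summing the recursion over the index writes the `s`-th difference as `1 / (1 + aq)` times a
combination, with coefficients `(aq)^j`, of differences at `aq`. Only the `j = 0` coefficient does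
not tend to `0` with `a`. -/
theorem norm_diff_le {a q : ℂ} (hq : ‖q‖ < 1)
    (ha : ∀ j : ℕ, a ^ 2 * q ^ 2 * (q ^ 2) ^ j ≠ 1) {s : ℕ} (hs : s ≤ 5) :
    ‖F124 s a q - Q 1 2 4 s a q‖
      ≤ ‖1 / (1 + a * q)‖ * (∑ j ∈ Finset.range s, ‖a * q‖ ^ j) * ‖diffVec (a * q) q‖ := by
  induction s with
  | zero => simp [F124, F124Term, Q_zero_index]
  | succ s ih =>
    have hst : s + (4 - s) = 4 := by omega
    rw [F124_succ hst hq (sq_shift_ne_one ha), Q_succ hst hq ha, Finset.sum_range_succ]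
    have hv : ‖F124 (4 - s + 1) (a * q) q - Q 1 2 4 (4 - s + 1) (a * q) q‖
        ≤ ‖diffVec (a * q) q‖ := norm_le_pi_norm (diffVec (a * q) q) ⟨4 - s, by omega⟩
    calc _ = ‖(F124 s a q - Q 1 2 4 s a q) + 1 / (1 + a * q) * (a * q) ^ s
            * (F124 (4 - s + 1) (a * q) q - Q 1 2 4 (4 - s + 1) (a * q) q)‖ := by
          congr 1
          ring
      _ ≤ ‖1 / (1 + a * q)‖ * (∑ j ∈ Finset.range s, ‖a * q‖ ^ j) * ‖diffVec (a * q) q‖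
            + ‖1 / (1 + a * q)‖ * ‖a * q‖ ^ s * ‖diffVec (a * q) q‖ := by
          refine (norm_add_le _ _).trans (add_le_add (ih (by omega)) ?_)
          rw [norm_mul, norm_mul, norm_pow]
          gcongr
      _ = _ := by ring

theorem norm_diffVec_le {a q : ℂ} (hq : ‖q‖ < 1)
    (ha : ∀ j : ℕ, a ^ 2 * q ^ 2 * (q ^ 2) ^ j ≠ 1) :
    ‖diffVec a q‖
      ≤ ‖1 / (1 + a * q)‖ * (∑ j ∈ Finset.range 5, ‖a * q‖ ^ j) * ‖diffVec (a * q) q‖ := by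
  refine (pi_norm_le_iff_of_nonneg (by positivity)).mpr fun i => ?_
  refine (norm_diff_le hq ha (s := i + 1) (by omega)).trans ?_
  gcongr
  omega

theorem F124_eq_Q {a q : ℂ} (hq : ‖q‖ < 1) (ha : ∀ j : ℕ, a ^ 2 * q ^ 2 * (q ^ 2) ^ j ≠ 1)
    {i : ℕ} (hi : i ∈ Finset.Icc 1 5) : F124 i a q = Q 1 2 4 i a q := by
  have ha' := sq_shift_ne_one ha
  obtain ⟨B, hB0, hB⟩ := exists_norm_inv_qPoch_le hq ha'
  set A := ‖a‖ with hA
  set S := 1 + A + A ^ 2 + A ^ 3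
  have hA0 : 0 ≤ A := norm_nonneg a
  have hS0 : 0 ≤ S := by positivity
  have hlim : Tendsto (fun m : ℕ => diffVec (a * q ^ m) q) atTop (𝓝 0) := by
    refine tendsto_pi_nhds.mpr fun i => ?_
    have h1 := tendsto_F124 hq ha' (i := i + 1) (by simp)
    have h2 := tendsto_Q (i := i + 1) (by omega) hq ha
    simpa [diffVec] using h1.sub h2
  -- With `x = a q^(m+1)`, the constant comes from `|1 / (1 + x)| ≤ 1 + B|x|`, from `∑_{j<5} |x|^j ≤
  -- 1 + S|x|`, and from `|x| ≤ A` and `|x| ≤ A|q|^m`.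
  have hstep : ∀ m : ℕ, ‖diffVec (a * q ^ m) q‖
      ≤ (1 + (B + S + B * A * S) * A * ‖q‖ ^ m) * ‖diffVec (a * q ^ (m + 1)) q‖ := by
    intro m
    have h1 := norm_diffVec_le hq (sq_ne_one_shift ha m)
    rw [show a * q ^ m * q = a * q ^ (m + 1) by ring] at h1
    refine h1.trans (mul_le_mul_of_nonneg_right ?_ (norm_nonneg _))
    have hne := one_add_ne_zero_of_ne ha' m
    have hinv : ‖(1 + a * q ^ (m + 1))⁻¹‖ ≤ B := by
      have := hB m 1
      rwa [qPoch_succ, qPoch_zero, one_mul, pow_zero, mul_one,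
        show 1 - -a * q * q ^ m = 1 + a * q ^ (m + 1) by ring] at this
    set x := a * q ^ (m + 1) with hx
    have hxA : ‖x‖ ≤ A := norm_mul_pow_le a hq _
    have hxm : ‖x‖ ≤ A * ‖q‖ ^ m := by
      rw [hx, pow_succ, ← mul_assoc, norm_mul, norm_mul, norm_pow]
      exact mul_le_of_le_one_right (by positivity) hq.le
    have hv : ‖1 / (1 + x)‖ ≤ 1 + B * ‖x‖ := by
      rw [show 1 / (1 + x) = 1 - (1 + x)⁻¹ * x by field_simp; ring]
      refine (norm_sub_le _ _).trans ?_
      rw [norm_one, norm_mul]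
      gcongr
    have hs : ∑ j ∈ Finset.range 5, ‖x‖ ^ j ≤ 1 + S * ‖x‖ := by
      have : ∑ j ∈ Finset.range 5, ‖x‖ ^ j = 1 + (1 + ‖x‖ + ‖x‖ ^ 2 + ‖x‖ ^ 3) * ‖x‖ := by
        simp [Finset.sum_range_succ]
        ring
      rw [this]
      gcongr
      change _ ≤ 1 + A + A ^ 2 + A ^ 3
      gcongr
    calc _ ≤ (1 + B * ‖x‖) * (1 + S * ‖x‖) := by gcongr
      _ = 1 + (B + S + B * ‖x‖ * S) * ‖x‖ := by ring
      _ ≤ 1 + (B + S + B * A * S) * (A * ‖q‖ ^ m) := by gcongr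
      _ = _ := by ring
  have h0 := tendsto_zero_of_norm_le_one_add_mul (fun m => by positivity)
    ((summable_geometric_of_lt_one (norm_nonneg q) hq).mul_left _) hstep hlim
  rw [pow_zero, mul_one] at h0
  rw [Finset.mem_Icc] at hi
  have h1 := congrFun h0 ⟨i - 1, by omega⟩
  simp only [diffVec, Nat.sub_add_cancel hi.1, Pi.zero_apply] at h1
  exact sub_eq_zero.mp h1

/-! ### The case `a = 1`: products of modulus 11. -/

theorem tsum_QTerm_one {i : ℕ} (hi : i ∈ Finset.Icc 1 5) {q : ℂ} (hq : ‖q‖ < 1) :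
    ∑' n, QTerm 1 2 4 i 1 q n
      = qPochInf (q ^ i) (q ^ 11) * qPochInf (q ^ (11 - i)) (q ^ 11)
        * qPochInf (q ^ 11) (q ^ 11) := by
  rw [Finset.mem_Icc] at hi
  have e : q ^ i * q ^ (11 - i) = q ^ 11 := by rw [← pow_add]; congr 1; omega
  have h := tripleProduct (x := q ^ i) (y := q ^ (11 - i))
    (by rw [e]; exact norm_pow_lt_one hq (by norm_num))
  rw [e] at h
  rw [h]
  refine tsum_congr fun n => ?_
  have hT : n * (n + 1) / 2 = n.choose 2 + n := by
    rw [mul_comm, show (n + 1) * n / 2 = (n + 1).choose 2 from (Nat.choose_two_right _).symm,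
      Nat.choose_succ_succ' n 1, Nat.choose_one_right, add_comm]
  -- Removes `n ^ 2` in favour of `n.choose 2`, so that both exponents become linear in `n` and
  -- `n.choose 2`.
  have hT2 : 2 * n.choose 2 + n = n ^ 2 := by
    have : n * (n + 1) / 2 * 2 = n * (n + 1) :=
      Nat.div_mul_cancel (Nat.even_mul_succ_self n).two_dvd
    rw [hT] at this
    nlinarith
  rw [QTerm_eq (show i + (5 - i) = 5 by omega), hT, one_mul,
    mul_inv_cancel_right₀ (qPoch_ne_zero (self_pow_mul_ne_one hq) n), ← hT2]
  obtain ⟨h1, h2⟩ := hi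
  interval_cases i <;> norm_num <;> ring

theorem hasSum_F124_one {i : ℕ} (hi : i ∈ Finset.Icc 1 5) {q : ℂ} (hq : ‖q‖ < 1) :
    HasSum (fun p : ℕ × ℕ => F124Term i 1 q p.1 p.2)
      (qPochInf (q ^ i) (q ^ 11) * qPochInf (q ^ (11 - i)) (q ^ 11)
        * qPochInf (q ^ 11) (q ^ 11) / qPochInf (q ^ 2) (q ^ 2)) := by
  have ha : ∀ j : ℕ, (1 : ℂ) ^ 2 * q ^ 2 * (q ^ 2) ^ j ≠ 1 := fun j => by
    rw [one_pow, one_mul]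
    exact self_pow_mul_ne_one (norm_pow_lt_one hq two_ne_zero) j
  have h1 := (summable_F124Term hq (sq_shift_ne_one ha) hi).hasSum
  have h2 := F124_eq_Q hq ha hi
  rw [Q, tsum_QTerm_one hi hq, one_pow, one_mul, one_div_mul_eq_div] at h2
  rwa [← h2]

theorem mainTheorem3 (q : ℂ) (hq : ‖q‖ < 1) :
    -- the `a`-identities, with convergence of all series and products involved
    (∀ a : ℂ, (∀ j : ℕ, 1 ≤ j → a ^ 2 * q ^ (2 * j) ≠ 1) →
      (∀ i ∈ Finset.Icc 1 5,
        Summable (fun p : ℕ × ℕ => F124Term i a q p.1 p.2) ∧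
        qPochInf (a ^ 2 * q ^ 2) (q ^ 2) ≠ 0 ∧
        Summable (QTerm 1 2 4 i a q) ∧
        F124 i a q = Q 1 2 4 i a q) ∧
      -- the system of `q`-difference equations linking the five series
      F124 1 a q = 1 / (1 + a * q) * F124 5 (a * q) q ∧
      F124 2 a q = F124 1 a q + a * q / (1 + a * q) * F124 4 (a * q) q ∧
      F124 3 a q = F124 2 a q + a ^ 2 * q ^ 2 / (1 + a * q) * F124 3 (a * q) q ∧
      F124 4 a q = F124 3 a q + a ^ 3 * q ^ 3 / (1 + a * q) * F124 2 (a * q) q ∧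
      F124 5 a q = F124 4 a q + a ^ 4 * q ^ 4 / (1 + a * q) * F124 1 (a * q) q) ∧
    -- the initial conditions
    (∀ i ∈ Finset.Icc 1 5, F124 i 0 q = 1) ∧
    -- the five identities of Rogers-Ramanujan type related to the modulus 11
    qPochInf (q ^ 2) (q ^ 2) ≠ 0 ∧
    HasSum (fun p : ℕ × ℕ =>
        q ^ (2 * p.1 ^ 2 + 4 * p.1 * p.2 + 4 * p.2 ^ 2 + 2 * p.1 + 4 * p.2)
          / (qPoch (-q) q (2 * p.2 + 1) * qPoch (q ^ 2) (q ^ 2) p.2 * qPoch (q ^ 2) (q ^ 2) p.1))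
      (qPochInf q (q ^ 11) * qPochInf (q ^ 10) (q ^ 11) * qPochInf (q ^ 11) (q ^ 11)
        / qPochInf (q ^ 2) (q ^ 2)) ∧
    HasSum (fun p : ℕ × ℕ =>
        q ^ (2 * p.1 ^ 2 + 4 * p.1 * p.2 + 4 * p.2 ^ 2 + 2 * p.1 + 4 * p.2)
          / (qPoch (-q) q (2 * p.2) * qPoch (q ^ 2) (q ^ 2) p.2 * qPoch (q ^ 2) (q ^ 2) p.1))
      (qPochInf (q ^ 2) (q ^ 11) * qPochInf (q ^ 9) (q ^ 11) * qPochInf (q ^ 11) (q ^ 11)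
        / qPochInf (q ^ 2) (q ^ 2)) ∧
    HasSum (fun p : ℕ × ℕ =>
        q ^ (2 * p.1 ^ 2 + 4 * p.1 * p.2 + 4 * p.2 ^ 2 + 2 * p.2)
            * (1 + q ^ (2 * p.1 + 2 * p.2 + 1))
          / (qPoch (-q) q (2 * p.2 + 1) * qPoch (q ^ 2) (q ^ 2) p.2 * qPoch (q ^ 2) (q ^ 2) p.1))
      (qPochInf (q ^ 3) (q ^ 11) * qPochInf (q ^ 8) (q ^ 11) * qPochInf (q ^ 11) (q ^ 11)
        / qPochInf (q ^ 2) (q ^ 2)) ∧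
    HasSum (fun p : ℕ × ℕ =>
        q ^ (2 * p.1 ^ 2 + 4 * p.1 * p.2 + 4 * p.2 ^ 2 + 2 * p.2)
          / (qPoch (-q) q (2 * p.2) * qPoch (q ^ 2) (q ^ 2) p.2 * qPoch (q ^ 2) (q ^ 2) p.1))
      (qPochInf (q ^ 4) (q ^ 11) * qPochInf (q ^ 7) (q ^ 11) * qPochInf (q ^ 11) (q ^ 11)
        / qPochInf (q ^ 2) (q ^ 2)) ∧
    HasSum (fun p : ℕ × ℕ =>
        q ^ (2 * p.1 ^ 2 + 4 * p.1 * p.2 + 4 * p.2 ^ 2)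
          / (qPoch (-q) q (2 * p.2) * qPoch (q ^ 2) (q ^ 2) p.2 * qPoch (q ^ 2) (q ^ 2) p.1))
      (qPochInf (q ^ 5) (q ^ 11) * qPochInf (q ^ 6) (q ^ 11) * qPochInf (q ^ 11) (q ^ 11)
        / qPochInf (q ^ 2) (q ^ 2)) := by
  have hq2 : ‖q ^ 2‖ < 1 := norm_pow_lt_one hq two_ne_zero
  refine ⟨fun a ha => ?_, fun i hi => F124_zero hi q,
    qPochInf_ne_zero hq2 (self_pow_mul_ne_one hq2), ?_, ?_, ?_, ?_, ?_⟩
  · have hsq : ∀ j : ℕ, a ^ 2 * q ^ 2 * (q ^ 2) ^ j ≠ 1 := fun j => by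
      have := ha (j + 1) (by omega)
      rwa [show a ^ 2 * q ^ (2 * (j + 1)) = a ^ 2 * q ^ 2 * (q ^ 2) ^ j by ring] at this
    have ha' := sq_shift_ne_one hsq
    exact ⟨fun i hi => ⟨summable_F124Term hq ha' hi, qPochInf_ne_zero hq2 hsq,
      summable_QTerm i a hq, F124_eq_Q hq hsq hi⟩, F124_one, F124_two hq ha', F124_three hq ha',
      F124_four hq ha', F124_five hq ha'⟩
  · simpa [F124Term] using hasSum_F124_one (i := 1) (by simp) hq
  · simpa [F124Term] using hasSum_F124_one (i := 2) (by simp) hq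
  · simpa [F124Term] using hasSum_F124_one (i := 3) (by simp) hq
  · simpa [F124Term] using hasSum_F124_one (i := 4) (by simp) hq
  · simpa [F124Term] using hasSum_F124_one (i := 5) (by simp) hq
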